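/- Write points of the hypercube as $x\in\{-1,1\}^n$, and let $x_{i+}$, $x_{i-}$ be $x$ with the $i$-th coordinate replaced by $1$, $-1$. For $f:\{-1,1\}^n\to\mathbb R$ let $D_if(x)=\frac{f(x_{i+})-f(x_{i-})}{2}$ and $Df(x)=(D_1f(x),\dots,D_nf(x))$. A function $\tilde D:\{-1,1\}^n\to\mathbb R^{n_1}$ is a pseudo discrete derivative for $f$ if $\|\tilde D(x)\|_2\ge\|Df(x)\|_2$ for all $x$. A function $\tilde H:\{-1,1\}^n\to\mathbb R^{n_1\times n_2}$ is a pseudo discrete Hessian with respect to $\tilde D$ if $\|u^\top\tilde H(x)\|_2\ge\|D(u^\top\tilde D)(x)\|_2$ for all $u\in\mathbb R^{n_1}$ and all $x\in\{-1,1\}^n$. For a random vector $X$ in $\{-1,1\}^n$, let the influence $I(j,i)$ of $j$ on $i$ be the maximum, over all pairs $x,y\in\{-1,1\}^n$ that differ only in coordinate $j$, of the total variation distance between the conditional laws of $X_i$ given $X_{-i}=x_{-i}$ and given $X_{-i}=y_{-i}$. Call $X$ $(\alpha,\gamma)$-bounded if $\max_i\sum_j I(j,i)\le\alpha$ and $\Pr[X_i=s\mid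 X_{-i}=x_{-i}]\ge\gamma$ for all $i$, all $s\in\{-1,1\}$ and all $x\in\{-1,1\}^n$. **Theorem.** Let $\alpha<1$ (Dobrushin's condition) and $\gamma>0$. There is a constant $c>0$ that depends only on $\alpha$ and $\gamma$ such that for all $n,n_1,n_2$, every $(\alpha,\gamma)$-bounded random vector $X$ in $\{-1,1\}^n$, every function $f:\{-1,1\}^n\to\mathbb R$, every pseudo discrete derivative $\tilde D$ (with values in $\mathbb R^{n_1}$) for $f$, every pseudo discrete Hessian $\tilde H$ (with values in $\mathbb R^{n_1\times n_2}$) with respect to $\tilde D$, and every $t>0$, $$ \Pr\big[|f(X)-\mathbb E f(X)|>t\big]\le 2\exp\left(-c\min\left(\frac{t^2}{\|\mathbb E\tilde D(X)\|_2^2+\max_x\|\tilde H(x)\|_F^2},\ \frac{t}{\max_x\|\tilde H(x)\|_2}\right)\right), $$ where $\|\cdot\|_F$ and $\|\cdot\|_2$ are the Frobenius and the spectral norm of a matrix, a quotient with denominator $0$ is read as $+\infty$, and $\exp(-\infty)=0$. -/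

import Mathlib

open MeasureTheory ProbabilityTheory
open scoped ENNReal

/-- Every subset of `{-1, 1}` is measurable. -/
instance : DiscreteMeasurableSpace ℤˣ where
  forall_measurableSet s :=
    ⟨Units.val '' s, MeasurableSet.of_discrete, Set.preimage_image_eq s Units.val_injective⟩

/-- The hypercube `{-1, 1}^n`. -/
abbrev Cube (n : ℕ) : Type := Fin n → ℤˣ

/-- The discrete derivative `D_i f(x) = (f(x_{i+}) - f(x_{i-})) / 2`, where `x_{i+}` and `x_{i-}` are
obtained from `x` by replacing the `i`-th coordinate with `1` and `-1`. -/
noncomputable def discreteDeriv {n : ℕ} (f : Cube n → ℝ) (i : Fin n) (x : Cube n) : ℝ :=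
  (f (Function.update x i 1) - f (Function.update x i (-1))) / 2

/-- The vector `Df(x)` of all discrete derivatives, with the Euclidean norm. -/
noncomputable def discreteGrad {n : ℕ} (f : Cube n → ℝ) (x : Cube n) :
    EuclideanSpace ℝ (Fin n) :=
  WithLp.toLp 2 fun i => discreteDeriv f i x

/-- `D` is a pseudo discrete derivative for `f`: `‖D(x)‖₂ ≥ ‖Df(x)‖₂` for all `x`. -/
def IsPseudoDeriv {n n₁ : ℕ} (f : Cube n → ℝ) (D : Cube n → EuclideanSpace ℝ (Fin n₁)) : Prop :=
  ∀ x, ‖discreteGrad f x‖ ≤ ‖D x‖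

/-- `H` is a pseudo discrete Hessian with respect to `D`: for every vector `u` and every `x`,
`‖uᵀ H(x)‖₂ ≥ ‖D(uᵀ D)(x)‖₂`. -/
def IsPseudoHessian {n n₁ n₂ : ℕ} (D : Cube n → EuclideanSpace ℝ (Fin n₁))
    (H : Cube n → Matrix (Fin n₁) (Fin n₂) ℝ) : Prop :=
  ∀ (u : Fin n₁ → ℝ) (x : Cube n),
    ‖discreteGrad (fun y => ∑ k, u k * D y k) x‖ ≤ ‖WithLp.toLp 2 (Matrix.vecMul u (H x))‖

/-- The Frobenius norm of a real matrix. -/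
noncomputable def frobNorm {m k : ℕ} (A : Matrix (Fin m) (Fin k) ℝ) : ℝ :=
  √(∑ i, ∑ j, A i j ^ 2)

/-- The spectral norm of a real matrix: its operator norm between Euclidean spaces. -/
noncomputable def specNorm {m k : ℕ} (A : Matrix (Fin m) (Fin k) ℝ) : ℝ :=
  ‖LinearMap.toContinuousLinearMap (Matrix.toEuclideanLin A)‖

/-- `Pr[X_i = s | X_{-i} = x_{-i}]` for `X` with law `π`. It is `0` if `X_{-i} = x_{-i}` has
probability zero. -/
noncomputable def condProb {n : ℕ} (π : Measure (Cube n)) (i : Fin n) (x : Cube n) (s : ℤˣ) : ℝ :=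
  (ProbabilityTheory.cond π {y | ∀ k, k ≠ i → y k = x k}).real {y | y i = s}

/-- Total variation distance between the conditional laws of the `i`-th coordinate given
`x_{-i}` and given `y_{-i}`. -/
noncomputable def condTV {n : ℕ} (π : Measure (Cube n)) (i : Fin n) (x y : Cube n) : ℝ :=
  (∑ s : ℤˣ, |condProb π i x s - condProb π i y s|) / 2

/-- The influence `I(j, i)` of the coordinate `j` on the coordinate `i`: the maximum of the total
variation distance over all pairs of states that differ only in their value at `j`. -/
noncomputable def influence {n : ℕ} (π : Measure (Cube n)) (j i : Fin n) : ℝ :=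
  ⨆ p : {p : Cube n × Cube n // p.1 j ≠ p.2 j ∧ ∀ k, k ≠ j → p.1 k = p.2 k},
    condTV π i p.1.1 p.1.2

/-- The Dobrushin coefficient `max_i ∑_j I(j, i)`. -/
noncomputable def dobrushinCoeff {n : ℕ} (π : Measure (Cube n)) : ℝ :=
  ⨆ i, ∑ j, influence π j i

/-- `(α, γ)`-bounded laws on the hypercube: the Dobrushin coefficient is at most `α`, and every
coordinate takes each of its two values with conditional probability at least `γ`, whatever the
other coordinates are. For `0 < γ` the second condition forces full support (as does its variant that
only looks at conditioning events of positive probability), so that all conditional laws exist. -/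
structure IsDobrushinBounded {n : ℕ} (α γ : ℝ) (π : Measure (Cube n)) : Prop where
  coeff_le : dobrushinCoeff π ≤ α
  le_condProb : ∀ (i : Fin n) (x : Cube n) (s : ℤˣ), γ ≤ condProb π i x s

/-- `min (t² / (‖E D(X)‖₂² + max_x ‖H(x)‖_F²), t / max_x ‖H(x)‖₂)` for a random vector `X` on the
probability space `(Ω, P)`, with the convention `t / 0 = ∞` for `t > 0`. -/
noncomputable def tailExponent {Ω : Type*} [MeasurableSpace Ω] (P : Measure Ω) {n n₁ n₂ : ℕ}
    (X : Ω → Cube n) (D : Cube n → EuclideanSpace ℝ (Fin n₁))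
    (H : Cube n → Matrix (Fin n₁) (Fin n₂) ℝ) (t : ℝ) : ℝ≥0∞ :=
  min
    (ENNReal.ofReal (t ^ 2) /
      ENNReal.ofReal (‖∫ ω, D (X ω) ∂P‖ ^ 2 + ⨆ x, frobNorm (H x) ^ 2))
    (ENNReal.ofReal t / ENNReal.ofReal (⨆ x, specNorm (H x)))

/-! The law of `X` satisfies a modified logarithmic Sobolev inequality whose constant depends only
on `α` and `γ`. The entropy method is then used twice: for `f`, and for the squared distance of the
pseudo derivative from its mean.

The inequality rests on approximate tensorization of entropy (`cEnt_univ_le`). Dobrushin's condition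
bounds the row sums of the influence matrix `M`, hence those of the resolvent `(1 - M)⁻¹`, and
iterating the heat bath bounds covariances by this resolvent (`abs_cCov_le`). Row sums suffice for
entropic independence (`sum_cCov_up_sq_le`): freezing a uniformly random site of `S` loses on
average at most a fraction `N / |S|` of the entropy, so a random set of density `θ` retains the
fraction `θ ^ N` (`pow_mul_le_bern`). Tensorizing on `S` also needs column sums of the resolvent,
which row sums do not control. The column sums of `M` itself are bounded, because with two spin
values and conditional probabilities bounded below the influences of `j` on `l` and of `l` on `j`
are comparable (`influence_le_mul_influence`). At low density the resolvent of a random subsystem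
then has column sums of bounded expectation (`bern_resolv_col_le`).

The Gibbs variational principle and Herbst's argument turn the log-Sobolev inequality into `log E
e^f ≤ E f + log E e^(2C|∇f|²)` (`log_cE_exp_le`); small multiples of `f` give Poincaré
(`variance_le`). Now `|∇f|²` is at most `8‖E D‖² + 8W` with `W = ‖D - E D‖²`. The Hessian makes `W`
self-bounding, `|∇W|² ≤ 32h²(W + F2)` (`gradSq_sq_dist_le`), where `h` and `F2` bound the spectral
norm and the squared Frobenius norm. The same inequality applied to `W` therefore closes, with `E W`
bounded by Poincaré. Chernoff's bound finishes the proof. -/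

namespace CubeConc

variable {n : ℕ}

/-! ### Conditional expectations on fibers of the cube -/

/-- The configurations that agree with `x` off `S`. -/
def fiber (S : Finset (Fin n)) (x : Cube n) : Finset (Cube n) :=
  Finset.univ.filter fun y => ∀ k ∉ S, y k = x k

@[simp] lemma mem_fiber {S : Finset (Fin n)} {x y : Cube n} :
    y ∈ fiber S x ↔ ∀ k ∉ S, y k = x k := by simp [fiber]

lemma self_mem_fiber (S : Finset (Fin n)) (x : Cube n) : x ∈ fiber S x := by simp

lemma fiber_congr {S : Finset (Fin n)} {x y : Cube n} (h : y ∈ fiber S x) :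
    fiber S y = fiber S x := by
  rw [mem_fiber] at h
  ext z
  simp only [mem_fiber]
  exact forall₂_congr fun k hk => by rw [h k hk]

/-- The conditional expectation of `g` given the coordinates off `S`, for the weights `p`. -/
noncomputable def cE (p : Cube n → ℝ) (S : Finset (Fin n)) (g : Cube n → ℝ) (x : Cube n) : ℝ :=
  (∑ y ∈ fiber S x, p y * g y) / ∑ y ∈ fiber S x, p y

/-- The indicator of `x k = 1`. -/
def up (k : Fin n) (x : Cube n) : ℝ := if x k = 1 then 1 else 0

/-- The difference of `g` in the coordinate `k`. -/
def diff (k : Fin n) (g : Cube n → ℝ) (x : Cube n) : ℝ :=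
  g (Function.update x k 1) - g (Function.update x k (-1))

section
variable {p : Cube n → ℝ} (hp : ∀ x, 0 < p x) {S T : Finset (Fin n)} {x : Cube n}
include hp

lemma fiber_sum_pos (S : Finset (Fin n)) (x : Cube n) : 0 < ∑ y ∈ fiber S x, p y :=
  Finset.sum_pos (fun y _ => hp y) ⟨x, self_mem_fiber S x⟩

omit hp in
lemma cE_congr {g h : Cube n → ℝ} (e : ∀ y ∈ fiber S x, g y = h y) : cE p S g x = cE p S h x := by
  unfold cE
  rw [Finset.sum_congr rfl fun y hy => by rw [e y hy]]

omit hp in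
lemma cE_agree (g : Cube n → ℝ) {y : Cube n} (h : y ∈ fiber S x) : cE p S g y = cE p S g x := by
  unfold cE
  rw [fiber_congr h]

omit hp in
lemma cE_add (g h : Cube n → ℝ) :
    cE p S (fun y => g y + h y) x = cE p S g x + cE p S h x := by
  unfold cE
  rw [← add_div, ← Finset.sum_add_distrib]
  simp only [mul_add]

omit hp in
lemma cE_smul (c : ℝ) (g : Cube n → ℝ) : cE p S (fun y => c * g y) x = c * cE p S g x := by
  unfold cE
  rw [← mul_div_assoc, Finset.mul_sum]
  simp only [mul_left_comm]

omit hp in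
lemma cE_sub (g h : Cube n → ℝ) :
    cE p S (fun y => g y - h y) x = cE p S g x - cE p S h x := by
  have := cE_add (p := p) (S := S) (x := x) g (fun y => (-1) * h y)
  rw [cE_smul] at this
  rw [sub_eq_add_neg, ← neg_one_mul, ← this]
  exact cE_congr fun y _ => by ring

omit hp in
lemma cE_sum {ι : Type*} (A : Finset ι) (g : ι → Cube n → ℝ) :
    cE p S (fun y => ∑ i ∈ A, g i y) x = ∑ i ∈ A, cE p S (g i) x := by
  unfold cE
  rw [← Finset.sum_div, Finset.sum_comm]
  simp only [Finset.mul_sum]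

lemma cE_const (c : ℝ) : cE p S (fun _ => c) x = c := by
  unfold cE
  rw [← Finset.sum_mul]
  field_simp [(fiber_sum_pos hp S x).ne']

lemma cE_mono {g h : Cube n → ℝ} (e : ∀ y ∈ fiber S x, g y ≤ h y) : cE p S g x ≤ cE p S h x := by
  unfold cE
  gcongr with y hy
  · exact (fiber_sum_pos hp S x).le
  · exact (hp y).le
  · exact e y hy

lemma cE_nonneg {g : Cube n → ℝ} (e : ∀ y, 0 ≤ g y) : 0 ≤ cE p S g x := by
  rw [← cE_const hp (S := S) (x := x) 0]
  exact cE_mono hp fun y _ => e y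

lemma cE_pos {g : Cube n → ℝ} (e : ∀ y, 0 < g y) : 0 < cE p S g x :=
  div_pos (Finset.sum_pos (fun y _ => mul_pos (hp y) (e y)) ⟨x, self_mem_fiber S x⟩)
    (fiber_sum_pos hp S x)

lemma abs_cE_le (g : Cube n → ℝ) : |cE p S g x| ≤ cE p S (fun y => |g y|) x := by
  rw [abs_le]
  constructor
  · have := cE_mono hp (S := S) (x := x) (g := fun y => (-1) * |g y|) (h := g)
      fun y _ => by have := neg_abs_le (g y); linarith
    rw [cE_smul] at this
    linarith
  · exact cE_mono hp fun y _ => le_abs_self _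

omit hp in
lemma cE_mul_of_const {g h : Cube n → ℝ} (e : ∀ y ∈ fiber S x, h y = h x) :
    cE p S (fun y => h y * g y) x = h x * cE p S g x := by
  rw [← cE_smul]
  exact cE_congr fun y hy => by rw [e y hy]

lemma cE_empty (g : Cube n → ℝ) : cE p ∅ g x = g x := by
  rw [← cE_const hp (S := ∅) (x := x) (g x)]
  refine cE_congr fun y hy => ?_
  have : y = x := funext fun k => by simpa using mem_fiber.1 hy k
  rw [this]

lemma cE_cE (hST : S ⊆ T) (g : Cube n → ℝ) : cE p T (cE p S g) x = cE p T g x := by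
  unfold cE
  congr 1
  have key : ∀ y ∈ fiber T x, p y * ((∑ z ∈ fiber S y, p z * g z) / ∑ z ∈ fiber S y, p z) =
      ∑ z ∈ fiber T x, if z ∈ fiber S y then p y * (p z * g z) / ∑ u ∈ fiber S y, p u else 0 := by
    intro y hy
    rw [← Finset.sum_filter]
    have : (fiber T x).filter (fun z => z ∈ fiber S y) = fiber S y := by
      ext z
      simp only [Finset.mem_filter, mem_fiber] at hy ⊢
      refine ⟨fun h => h.2, fun h => ⟨fun k hk => ?_, h⟩⟩
      rw [h k fun hk' => hk (hST hk'), hy k hk]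
    rw [this, ← Finset.sum_div, ← Finset.mul_sum, mul_div_assoc]
  rw [Finset.sum_congr rfl key, Finset.sum_comm]
  refine Finset.sum_congr rfl fun z hz => ?_
  have key2 : ∀ y ∈ fiber T x, (if z ∈ fiber S y then p y * (p z * g z) / ∑ u ∈ fiber S y, p u
      else 0) = if y ∈ fiber S z then p y * ((p z * g z) / ∑ u ∈ fiber S z, p u) else 0 := by
    intro y _
    have : z ∈ fiber S y ↔ y ∈ fiber S z := by
      simp only [mem_fiber]
      exact forall₂_congr fun k _ => eq_comm
    by_cases h : y ∈ fiber S z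
    · rw [if_pos (this.2 h), if_pos h, fiber_congr h, mul_div_assoc]
    · rw [if_neg (fun h' => h (this.1 h')), if_neg h]
  rw [Finset.sum_congr rfl key2, ← Finset.sum_filter]
  have : (fiber T x).filter (fun y => y ∈ fiber S z) = fiber S z := by
    ext y
    simp only [Finset.mem_filter, mem_fiber] at hz ⊢
    refine ⟨fun h => h.2, fun h => ⟨fun k hk => ?_, h⟩⟩
    rw [h k fun hk' => hk (hST hk'), hz k hk]
  rw [this, ← Finset.sum_mul]
  field_simp [(fiber_sum_pos hp S z).ne']

/-- Cauchy–Schwarz for `u = (u / √v) * √v`. Below, `v` is a conditional mean of `g`, which is how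
energies normalized by the local mean arise. -/
lemma cE_sq_le {u v : Cube n → ℝ} (hv : ∀ y, 0 < v y) :
    cE p S u x ^ 2 ≤ cE p S (fun y => u y ^ 2 / v y) x * cE p S v x := by
  unfold cE
  rw [div_pow, div_mul_div_comm, ← sq]
  gcongr
  refine Finset.sum_sq_le_sum_mul_sum_of_sq_le_mul _
    (fun y _ => mul_nonneg (hp y).le (div_nonneg (sq_nonneg _) (hv y).le))
    (fun y _ => (mul_pos (hp y) (hv y)).le) fun y _ => le_of_eq ?_
  field_simp [(hv y).ne']

omit hp in
lemma update_mem_fiber {k : Fin n} (hk : k ∈ S) (s : ℤˣ) {y : Cube n} (h : y ∈ fiber S x) :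
    Function.update y k s ∈ fiber S x := by
  rw [mem_fiber] at h ⊢
  intro l hl
  rw [Function.update_of_ne fun e : l = k => hl (by rw [e]; exact hk), h l hl]

omit hp in
@[simp] lemma up_update_one (k : Fin n) (x : Cube n) : up k (Function.update x k 1) = 1 := by
  simp [up]

omit hp in
@[simp] lemma up_update_neg_one (k : Fin n) (x : Cube n) :
    up k (Function.update x k (-1)) = 0 := by
  simp [up]

omit hp in
lemma up_nonneg (k : Fin n) (x : Cube n) : 0 ≤ up k x := by unfold up; split_ifs <;> norm_num

omit hp in
lemma up_le_one (k : Fin n) (x : Cube n) : up k x ≤ 1 := by unfold up; split_ifs <;> norm_num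

/-- Averaging over `S` sees only the coordinate `k` of such a `φ`, so the conditional law collapses
to two atoms. -/
lemma cE_two_point {k : Fin n} (hk : k ∈ S) {φ : Cube n → ℝ}
    (hφ : ∀ y z, z ∈ fiber (S.erase k) y → φ z = φ y) :
    cE p S φ x = cE p S (up k) x * φ (Function.update x k 1) +
      (1 - cE p S (up k) x) * φ (Function.update x k (-1)) := by
  have h1 : cE p S φ x = cE p S (fun y => φ (Function.update x k (-1)) +
      (φ (Function.update x k 1) - φ (Function.update x k (-1))) * up k y) x := by
    refine cE_congr fun y hy => ?_
    have hmem : ∀ s, y k = s → y ∈ fiber (S.erase k) (Function.update x k s) := by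
      intro s hs
      rw [mem_fiber] at hy ⊢
      intro l hl
      by_cases e : l = k
      · subst e; simpa using hs
      · rw [Function.update_of_ne e]
        exact hy l fun h => hl (Finset.mem_erase.2 ⟨e, h⟩)
    rcases Int.units_eq_one_or (y k) with h | h
    · rw [hφ _ _ (hmem 1 h)]; simp [up, h]
    · rw [hφ _ _ (hmem (-1) h)]
      simp [up, h]
  rw [h1, cE_add, cE_smul, cE_const hp]
  ring

lemma cE_singleton (k : Fin n) (g : Cube n → ℝ) :
    cE p {k} g x = cE p {k} (up k) x * g (Function.update x k 1) +
      (1 - cE p {k} (up k) x) * g (Function.update x k (-1)) := by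
  refine cE_two_point hp (Finset.mem_singleton_self k) fun y z hz => ?_
  have : z = y := funext fun l => by simpa using mem_fiber.1 hz l
  rw [this]

/-! ### Conditional covariances -/

/-- The conditional covariance given the coordinates off `S`. -/
noncomputable def cCov (p : Cube n → ℝ) (S : Finset (Fin n)) (g F : Cube n → ℝ) (x : Cube n) : ℝ :=
  cE p S (fun y => g y * F y) x - cE p S g x * cE p S F x

omit hp in
lemma cCov_comm (g F : Cube n → ℝ) : cCov p S g F x = cCov p S F g x := by
  unfold cCov
  rw [mul_comm (cE p S g x)]
  simp only [mul_comm (g _)]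

omit hp in
lemma cCov_sum {ι : Type*} (A : Finset ι) (g : Cube n → ℝ) (u : ι → ℝ) (F : ι → Cube n → ℝ) :
    cCov p S g (fun y => ∑ i ∈ A, u i * F i y) x = ∑ i ∈ A, u i * cCov p S g (F i) x := by
  unfold cCov
  simp only [Finset.mul_sum, mul_sub, Finset.sum_sub_distrib]
  rw [cE_sum, cE_sum, Finset.mul_sum]
  congr 1
  · refine Finset.sum_congr rfl fun i _ => ?_
    rw [← cE_smul]
    exact cE_congr fun y _ => by ring
  · refine Finset.sum_congr rfl fun i _ => ?_
    rw [cE_smul]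
    ring

/-- Law of total covariance, from the tower property. -/
lemma cCov_chain (hST : S ⊆ T) (g F : Cube n → ℝ) :
    cCov p T g F x = cE p T (cCov p S g F) x + cCov p T (cE p S g) (cE p S F) x := by
  have : cE p T (cCov p S g F) x = cE p T (fun y => g y * F y) x -
      cE p T (fun y => cE p S g y * cE p S F y) x := by
    rw [← cE_cE hp hST (fun y => g y * F y), ← cE_sub]
    rfl
  rw [this]
  unfold cCov
  rw [cE_cE hp hST, cE_cE hp hST]
  ring

lemma cCov_two_point {k : Fin n} (hk : k ∈ S) {φ ψ : Cube n → ℝ}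
    (hφ : ∀ y z, z ∈ fiber (S.erase k) y → φ z = φ y)
    (hψ : ∀ y z, z ∈ fiber (S.erase k) y → ψ z = ψ y) :
    cCov p S φ ψ x = cE p S (up k) x * (1 - cE p S (up k) x) * (diff k φ x * diff k ψ x) := by
  unfold cCov diff
  rw [cE_two_point hp hk hφ, cE_two_point hp hk hψ,
    cE_two_point hp hk (φ := fun y => φ y * ψ y) fun y z h => by rw [hφ y z h, hψ y z h]]
  ring

omit hp in
lemma up_agree {k : Fin n} (hk : k ∉ S) (y z : Cube n) (h : z ∈ fiber S y) : up k z = up k y := by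
  unfold up
  rw [mem_fiber.1 h k hk]

/-- As `up k` depends on `x k` alone, `g` may first be averaged over the rest of `S`; what remains
is a two-point covariance. This translates between martingale increments and covariances with a
coordinate. -/
lemma cCov_up_eq {k : Fin n} (hk : k ∈ S) (g : Cube n → ℝ) :
    cCov p S g (up k) x = cE p S (up k) x * (1 - cE p S (up k) x) *
      diff k (cE p (S.erase k) g) x := by
  have hk' : k ∉ S.erase k := by simp
  have hsub : S.erase k ⊆ S := Finset.erase_subset _ _
  have h0 : cCov p S g (up k) x = cCov p S (cE p (S.erase k) g) (up k) x := by
    unfold cCov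
    rw [cE_cE hp hsub]
    congr 1
    rw [← cE_cE hp hsub (fun y => g y * up k y)]
    refine cE_congr fun y _ => ?_
    have := cE_mul_of_const (p := p) (S := S.erase k) (x := y) (g := g) (h := up k)
      (fun z hz => up_agree hk' y z hz)
    rw [mul_comm (cE p (S.erase k) g y), ← this]
    exact cE_congr fun z _ => mul_comm _ _
  rw [h0, cCov_two_point hp hk (fun y z h => cE_agree g h) (fun y z h => up_agree hk' y z h)]
  simp [diff]

lemma cCov_up_up {k : Fin n} (hk : k ∈ S) :
    cCov p S (up k) (up k) x = cE p S (up k) x * (1 - cE p S (up k) x) := by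
  have hk' : k ∉ S.erase k := by simp
  rw [cCov_two_point hp hk (fun y z h => up_agree hk' y z h) (fun y z h => up_agree hk' y z h)]
  simp [diff]

/-- The conditional variance of `up k` given all other coordinates. -/
noncomputable def var1 (p : Cube n → ℝ) (k : Fin n) (x : Cube n) : ℝ :=
  cE p {k} (up k) x * (1 - cE p {k} (up k) x)

lemma cCov_singleton (k : Fin n) (g F : Cube n → ℝ) :
    cCov p {k} g F x = var1 p k x * (diff k g x * diff k F x) := by
  have : ∀ φ : Cube n → ℝ, ∀ y z, z ∈ fiber (({k} : Finset (Fin n)).erase k) y → φ z = φ y := by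
    intro φ y z hz
    have : z = y := funext fun l => by simpa using mem_fiber.1 hz l
    rw [this]
  exact cCov_two_point hp (Finset.mem_singleton_self k) (this g) (this F)

omit hp in
lemma diff_sum {ι : Type*} (A : Finset ι) (u : ι → ℝ) (k : Fin n) (F : ι → Cube n → ℝ) :
    diff k (fun y => ∑ i ∈ A, u i * F i y) x = ∑ i ∈ A, u i * diff k (F i) x := by
  unfold diff
  rw [← Finset.sum_sub_distrib]
  exact Finset.sum_congr rfl fun i _ => by ring

omit hp in
lemma diff_up (i k : Fin n) : diff k (up i) x = if i = k then 1 else 0 := by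
  split_ifs with h
  · subst h; simp [diff]
  · simp [diff, up, Function.update_of_ne h]

lemma cE_up_mem {k : Fin n} : 0 ≤ cE p S (up k) x ∧ cE p S (up k) x ≤ 1 := by
  refine ⟨cE_nonneg hp (up_nonneg k), ?_⟩
  rw [← cE_const hp (S := S) (x := x) 1]
  exact cE_mono hp fun y _ => up_le_one k y

lemma var1_nonneg (k : Fin n) (x : Cube n) : 0 ≤ var1 p k x :=
  mul_nonneg (cE_up_mem hp).1 (sub_nonneg.2 (cE_up_mem hp).2)

omit hp in
lemma var1_le (k : Fin n) (x : Cube n) : var1 p k x ≤ 1 / 4 := by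
  unfold var1
  nlinarith [sq_nonneg (cE p {k} (up k) x - 1 / 2)]

end


/-! ### Weak dependence and covariance bounds by heat bath iteration -/

/-- Positive weights `p` whose one-site conditional probabilities lie in `[γ, 1 - γ]`, with influences
of `j` on `l` at most `M l j`, where `M` has row sums at most `α` and column sums at most `κ`. -/
structure WeaklyDependent (p : Cube n → ℝ) (M : Fin n → Fin n → ℝ) (α κ γ : ℝ) : Prop where
  pos : ∀ x, 0 < p x
  nonneg : ∀ l j, 0 ≤ M l j
  infl : ∀ l j, j ≠ l → ∀ x, |diff j (cE p {l} (up l)) x| ≤ M l j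
  row : ∀ l, ∑ j, M l j ≤ α
  col : ∀ j, ∑ l, M l j ≤ κ
  alpha_nonneg : 0 ≤ α
  alpha_lt : α < 1
  kappa_nonneg : 0 ≤ κ
  gamma_pos : 0 < γ
  gamma_le : γ ≤ 1 / 2
  le_cond : ∀ k x, γ ≤ cE p {k} (up k) x
  cond_le : ∀ k x, cE p {k} (up k) x ≤ 1 - γ

lemma abs_sub_le_of_mem_fiber {S : Finset (Fin n)} {F : Cube n → ℝ} {δ : Fin n → ℝ}
    (hδ : ∀ j ∈ S, ∀ x, |diff j F x| ≤ δ j) {x y : Cube n} (h : y ∈ fiber S x) :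
    |F y - F x| ≤ ∑ j ∈ S, δ j := by
  induction S using Finset.induction_on generalizing y with
  | empty =>
    have : y = x := funext fun k => by simpa using mem_fiber.1 h k
    simp [this]
  | insert j S hj ih =>
    rw [Finset.sum_insert hj]
    have h1 : Function.update y j (x j) ∈ fiber S x := by
      rw [mem_fiber] at h ⊢
      intro l hl
      by_cases e : l = j
      · subst e; simp
      · rw [Function.update_of_ne e]
        exact h l (by simp [e, hl])
    have h2 := ih (fun l hl => hδ l (Finset.mem_insert_of_mem hl)) h1
    have h3 : |F y - F (Function.update y j (x j))| ≤ δ j := by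
      have hd := hδ j (Finset.mem_insert_self _ _) y
      have hy : F y = F (Function.update y j (y j)) := by simp
      rw [hy]
      unfold diff at hd
      have h0 := (abs_nonneg _).trans hd
      rcases Int.units_eq_one_or (y j) with e1 | e1 <;>
        rcases Int.units_eq_one_or (x j) with e2 | e2 <;> rw [e1, e2]
      · simpa using h0
      · exact hd
      · rw [abs_sub_comm]; exact hd
      · simpa using h0
    calc |F y - F x| ≤ |F y - F (Function.update y j (x j))| +
          |F (Function.update y j (x j)) - F x| := abs_sub_le _ _ _
      _ ≤ _ := add_le_add h3 h2

lemma diff_cE_singleton_self {p : Cube n → ℝ} (l : Fin n) (F : Cube n → ℝ) (x : Cube n) :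
    diff l (cE p {l} F) x = 0 := by
  unfold diff
  rw [sub_eq_zero]
  refine cE_agree F (mem_fiber.2 fun k hk => ?_)
  have : k ≠ l := by simpa using hk
  simp [Function.update_of_ne this]

namespace WeaklyDependent

variable {p : Cube n → ℝ} {M : Fin n → Fin n → ℝ} {α κ γ : ℝ} (H : WeaklyDependent p M α κ γ)
  {S : Finset (Fin n)}
include H

/-- Dobrushin's one-step estimate. A change at `j` acts on `F` directly and also shifts the law that
resamples `l`; the shift is paid for with the oscillation of `F` at `l`. -/
lemma abs_diff_cE_singleton_le {l j : Fin n} (hlj : j ≠ l) {F : Cube n → ℝ} {a b : ℝ}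
    (ha : ∀ x, |diff j F x| ≤ a) (hb : ∀ x, |diff l F x| ≤ b) (x : Cube n) :
    |diff j (cE p {l} F) x| ≤ a + M l j * b := by
  have hw := H.infl l j hlj x
  have e : ∀ s, cE p {l} F (Function.update x j s) = _ := fun s =>
    cE_singleton H.pos l F (x := Function.update x j s)
  have h1 := ha (Function.update x l 1)
  have h2 := ha (Function.update x l (-1))
  have h3 := hb (Function.update x j (-1))
  have hm := cE_up_mem H.pos (S := {l}) (k := l) (x := Function.update x j 1)
  unfold diff at *
  rw [e, e]
  simp only [Function.update_comm hlj] at *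
  set A := cE p {l} (up l) (Function.update x j 1)
  set B := cE p {l} (up l) (Function.update x j (-1))
  generalize F (Function.update (Function.update x l 1) j 1) = f11 at *
  generalize F (Function.update (Function.update x l 1) j (-1)) = f10 at *
  generalize F (Function.update (Function.update x l (-1)) j 1) = f01 at *
  generalize F (Function.update (Function.update x l (-1)) j (-1)) = f00 at *
  -- Change `F` under the fixed weight `A`, then change the weight from `A` to `B`.
  have : A * f11 + (1 - A) * f01 - (B * f10 + (1 - B) * f00) =
      (A * (f11 - f10) + (1 - A) * (f01 - f00)) + (A - B) * (f10 - f00) := by ring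
  rw [this]
  refine (abs_add_le _ _).trans (add_le_add ((abs_add_le _ _).trans ?_) ?_)
  · rw [abs_mul, abs_mul, abs_of_nonneg hm.1, abs_of_nonneg (sub_nonneg.2 hm.2)]
    nlinarith [hm.1, hm.2]
  · rw [abs_mul]
    exact mul_le_mul hw h3 (abs_nonneg _) (H.nonneg _ _)

/-- Resampling `l` makes `F` constant in that coordinate, so in the law of total covariance for `{l}
⊆ S` exactly the local term disappears. -/
lemma cCov_sub_cE_singleton {l : Fin n} (hl : l ∈ S) (g F : Cube n → ℝ) (x : Cube n) :
    cCov p S g F x - cCov p S g (cE p {l} F) x =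
      cE p S (fun y => var1 p l y * (diff l g y * diff l F y)) x := by
  have hsub : {l} ⊆ S := Finset.singleton_subset_iff.2 hl
  rw [cCov_chain H.pos hsub g F, cCov_chain H.pos hsub g (cE p {l} F)]
  have h1 : cE p {l} (cE p {l} F) = cE p {l} F := funext fun y => cE_cE H.pos subset_rfl F
  have h2 : cE p S (cCov p {l} g (cE p {l} F)) x = 0 := by
    rw [← cE_const H.pos (S := S) (x := x) 0]
    refine cE_congr fun y _ => ?_
    rw [cCov_singleton H.pos, diff_cE_singleton_self]
    ring
  rw [h1, h2, cE_congr (fun y _ => cCov_singleton H.pos l g F (x := y))]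
  ring

/-- A crude bound, needed only for the remainder after `N` heat bath steps. -/
lemma abs_cCov_le_sum {g F : Cube n → ℝ} {δ : Fin n → ℝ} {G : ℝ} (hG : ∀ y, |g y| ≤ G)
    (hδ : ∀ j ∈ S, ∀ x, |diff j F x| ≤ δ j) (x : Cube n) :
    |cCov p S g F x| ≤ 2 * G * ∑ j ∈ S, δ j := by
  set D := ∑ j ∈ S, δ j
  have hF : ∀ y ∈ fiber S x, |F y - F x| ≤ D := fun y hy => abs_sub_le_of_mem_fiber hδ hy
  have hD : 0 ≤ D := (abs_nonneg _).trans (hF x (self_mem_fiber S x))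
  have hG0 : 0 ≤ G := (abs_nonneg _).trans (hG x)
  have e : cCov p S g F x = cE p S (fun y => g y * (F y - F x)) x -
      cE p S g x * cE p S (fun y => F y - F x) x := by
    unfold cCov
    rw [cE_sub, cE_const H.pos]
    have : cE p S (fun y => g y * (F y - F x)) x =
        cE p S (fun y => g y * F y) x - F x * cE p S g x := by
      rw [← cE_smul, ← cE_sub]
      exact cE_congr fun y _ => by ring
    rw [this]
    ring
  rw [e]
  have b1 : |cE p S (fun y => g y * (F y - F x)) x| ≤ G * D := by
    refine (abs_cE_le H.pos _).trans ?_
    rw [← cE_const H.pos (S := S) (x := x) (G * D)]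
    refine cE_mono H.pos fun y hy => ?_
    rw [abs_mul]
    exact mul_le_mul (hG y) (hF y hy) (abs_nonneg _) hG0
  have b2 : |cE p S g x| ≤ G := by
    refine (abs_cE_le H.pos _).trans ?_
    rw [← cE_const H.pos (S := S) (x := x) G]
    exact cE_mono H.pos fun y _ => hG y
  have b3 : |cE p S (fun y => F y - F x) x| ≤ D := by
    refine (abs_cE_le H.pos _).trans ?_
    rw [← cE_const H.pos (S := S) (x := x) D]
    exact cE_mono H.pos hF
  calc _ ≤ |cE p S (fun y => g y * (F y - F x)) x| +
        |cE p S g x * cE p S (fun y => F y - F x) x| := abs_sub _ _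
    _ ≤ G * D + G * D := by
        rw [abs_mul]
        exact add_le_add b1 (mul_le_mul b2 b3 (abs_nonneg _) hG0)
    _ = _ := by ring

/-- Replace `F` by its heat bath average over a uniform site of `S`, `m = |S|`. This costs local
covariances weighted by `δ / m` and turns the oscillations `δ` into `δ'`. The vector `r - δ / m` is
a supersolution for `δ'`, so the accumulated cost never exceeds `r`, while the total oscillation in
the remainder contracts geometrically. -/
lemma abs_cCov_le_iterate (hS : S.Nonempty) {g : Cube n → ℝ} {G : ℝ} (hG : ∀ y, |g y| ≤ G)
    (x : Cube n) (N : ℕ) : ∀ (F : Cube n → ℝ) (δ r : Fin n → ℝ),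
    (∀ j ∈ S, ∀ x, |diff j F x| ≤ δ j) → (∀ j ∈ S, 0 ≤ r j) →
    (∀ j ∈ S, δ j + ∑ l ∈ S, r l * M l j ≤ r j) →
    |cCov p S g F x| ≤ ∑ j ∈ S, r j * cE p S (fun y => var1 p j y * |diff j g y|) x +
      2 * G * ((1 - (1 - α) / (S.card : ℝ)) ^ N * ∑ j ∈ S, δ j) := by
  have hG0 : 0 ≤ G := (abs_nonneg _).trans (hG x)
  have hm1 : (1 : ℝ) ≤ S.card := by exact_mod_cast hS.card_pos
  obtain ⟨m, hm_def⟩ : ∃ m : ℝ, m = S.card := ⟨_, rfl⟩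
  rw [← hm_def] at hm1 ⊢
  have hm : 0 < m := by linarith
  have hα := H.alpha_lt
  have hα0 := H.alpha_nonneg
  have hρ : 0 ≤ 1 - (1 - α) / m := by
    rw [sub_nonneg, div_le_one hm]
    linarith
  have hb : ∀ j, 0 ≤ cE p S (fun y => var1 p j y * |diff j g y|) x := fun j =>
    cE_nonneg H.pos fun y => mul_nonneg (var1_nonneg H.pos j y) (abs_nonneg _)
  induction N with
  | zero =>
    intro F δ r hδ hr0 _
    have h := H.abs_cCov_le_sum hG hδ x
    have : 0 ≤ ∑ j ∈ S, r j * cE p S (fun y => var1 p j y * |diff j g y|) x :=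
      Finset.sum_nonneg fun j hj => mul_nonneg (hr0 j hj) (hb j)
    rw [pow_zero, one_mul]
    linarith
  | succ N ih =>
    intro F δ r hδ hr0 hr
    have hδ0 : ∀ j ∈ S, 0 ≤ δ j := fun j hj => (abs_nonneg _).trans (hδ j hj x)
    set PF : Cube n → ℝ := fun y => ∑ l ∈ S, m⁻¹ * cE p {l} F y with hPF
    set δ' : Fin n → ℝ := fun j => (1 - m⁻¹) * δ j + m⁻¹ * ∑ l ∈ S, δ l * M l j with hδ'
    set r' : Fin n → ℝ := fun j => r j - m⁻¹ * δ j with hr'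
    have hcard : ∑ l ∈ S, m⁻¹ = 1 := by
      rw [Finset.sum_const, nsmul_eq_mul, ← hm_def, mul_inv_cancel₀ hm.ne']
    have h1 : ∀ j ∈ S, ∀ y, |diff j PF y| ≤ δ' j := by
      intro j hj y
      rw [hPF, diff_sum, ← Finset.add_sum_erase _ _ hj, diff_cE_singleton_self, mul_zero, zero_add]
      have : ∀ l ∈ S.erase j, |m⁻¹ * diff j (cE p {l} F) y| ≤ m⁻¹ * (δ j + M l j * δ l) := by
        intro l hl
        rw [abs_mul, abs_of_pos (inv_pos.2 hm)]
        exact mul_le_mul_of_nonneg_left (H.abs_diff_cE_singleton_le (Finset.ne_of_mem_erase hl).symm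
          (hδ j hj) (hδ l (Finset.mem_of_mem_erase hl)) y) (inv_pos.2 hm).le
      refine ((Finset.abs_sum_le_sum_abs _ _).trans (Finset.sum_le_sum this)).trans ?_
      -- The site `l = j` contributed zero, which is where the factor `1 - m⁻¹` comes from. The
      -- diagonal influence is nonnegative, so it may be included in the bound.
      have e : ∑ l ∈ S.erase j, m⁻¹ * (δ j + M l j * δ l) =
          ∑ l ∈ S, m⁻¹ * (δ j + M l j * δ l) - m⁻¹ * (δ j + M j j * δ j) := by
        rw [← Finset.add_sum_erase _ _ hj]; ring
      have e2 : ∑ l ∈ S, m⁻¹ * (δ j + M l j * δ l) = δ j + m⁻¹ * ∑ l ∈ S, δ l * M l j := by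
        simp only [mul_add, Finset.sum_add_distrib]
        rw [← Finset.sum_mul, hcard, one_mul, Finset.mul_sum]
        simp only [mul_comm (M _ _)]
      rw [e, e2, hδ']
      have : 0 ≤ m⁻¹ * (M j j * δ j) :=
        mul_nonneg (inv_pos.2 hm).le (mul_nonneg (H.nonneg _ _) (hδ0 j hj))
      simp only
      nlinarith
    have hδr : ∀ j ∈ S, δ j ≤ r j := fun j hj => by
      have : 0 ≤ ∑ l ∈ S, r l * M l j :=
        Finset.sum_nonneg fun l hl => mul_nonneg (hr0 l hl) (H.nonneg _ _)
      linarith [hr j hj]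
    have hinv : m⁻¹ ≤ 1 := inv_le_one_of_one_le₀ hm1
    have h2 : ∀ j ∈ S, 0 ≤ r' j := fun j hj => by
      have := hδr j hj
      have := hδ0 j hj
      simp only [hr']
      nlinarith
    have h3 : ∀ j ∈ S, δ' j + ∑ l ∈ S, r' l * M l j ≤ r' j := by
      intro j hj
      have e : ∑ l ∈ S, r' l * M l j = ∑ l ∈ S, r l * M l j - m⁻¹ * ∑ l ∈ S, δ l * M l j := by
        rw [Finset.mul_sum, ← Finset.sum_sub_distrib]
        exact Finset.sum_congr rfl fun l _ => by simp only [hr']; ring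
      rw [e]
      simp only [hδ', hr']
      linarith [hr j hj]
    have h4 : |cCov p S g F x - cCov p S g PF x| ≤
        ∑ j ∈ S, m⁻¹ * δ j * cE p S (fun y => var1 p j y * |diff j g y|) x := by
      have : cCov p S g F x - cCov p S g PF x =
          ∑ l ∈ S, m⁻¹ * cE p S (fun y => var1 p l y * (diff l g y * diff l F y)) x := by
        rw [hPF, cCov_sum]
        have : cCov p S g F x = ∑ l ∈ S, m⁻¹ * cCov p S g F x := by
          rw [← Finset.sum_mul, hcard, one_mul]
        rw [this, ← Finset.sum_sub_distrib]
        refine Finset.sum_congr rfl fun l hl => ?_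
        rw [← H.cCov_sub_cE_singleton hl]
        ring
      rw [this]
      refine (Finset.abs_sum_le_sum_abs _ _).trans (Finset.sum_le_sum fun l hl => ?_)
      rw [abs_mul, abs_of_pos (inv_pos.2 hm), mul_assoc]
      refine mul_le_mul_of_nonneg_left ?_ (inv_pos.2 hm).le
      rw [← cE_smul]
      refine (abs_cE_le H.pos _).trans (cE_mono H.pos fun y _ => ?_)
      rw [abs_mul, abs_mul, abs_of_nonneg (var1_nonneg H.pos l y)]
      have := mul_le_mul_of_nonneg_left (hδ l hl y)
        (mul_nonneg (var1_nonneg H.pos l y) (abs_nonneg (diff l g y)))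
      linarith
    have h5 : ∑ j ∈ S, δ' j ≤ (1 - (1 - α) / m) * ∑ j ∈ S, δ j := by
      -- Exchanging the sums produces row sums of `M`; Dobrushin's condition gives the contraction.
      have : ∑ j ∈ S, ∑ l ∈ S, δ l * M l j ≤ α * ∑ j ∈ S, δ j := by
        rw [Finset.sum_comm, Finset.mul_sum]
        refine Finset.sum_le_sum fun l hl => ?_
        rw [← Finset.mul_sum, mul_comm]
        refine mul_le_mul_of_nonneg_right ?_ (hδ0 l hl)
        exact (Finset.sum_le_univ_sum_of_nonneg fun j => H.nonneg l j).trans (H.row l)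
      simp only [hδ']
      rw [Finset.sum_add_distrib, ← Finset.mul_sum, ← Finset.mul_sum]
      have := mul_le_mul_of_nonneg_left this (inv_pos.2 hm).le
      rw [div_eq_mul_inv]
      linarith
    have h6 := ih PF δ' r' h1 h2 h3
    have h7 : |cCov p S g F x| ≤ |cCov p S g F x - cCov p S g PF x| + |cCov p S g PF x| := by
      have := abs_add_le (cCov p S g F x - cCov p S g PF x) (cCov p S g PF x)
      rwa [sub_add_cancel] at this
    have h8 : 2 * G * ((1 - (1 - α) / m) ^ N * ∑ j ∈ S, δ' j) ≤
        2 * G * ((1 - (1 - α) / m) ^ (N + 1) * ∑ j ∈ S, δ j) := by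
      rw [pow_succ, mul_assoc ((1 - (1 - α) / m) ^ N)]
      gcongr
    have h9 : ∑ j ∈ S, m⁻¹ * δ j * cE p S (fun y => var1 p j y * |diff j g y|) x +
        ∑ j ∈ S, r' j * cE p S (fun y => var1 p j y * |diff j g y|) x =
        ∑ j ∈ S, r j * cE p S (fun y => var1 p j y * |diff j g y|) x := by
      rw [← Finset.sum_add_distrib]
      exact Finset.sum_congr rfl fun j _ => by simp only [hr']; ring
    linarith

/-- The covariance of `g` and `F` is controlled by any supersolution `r` of `r = δ F + r M`. -/
lemma abs_cCov_le {g F : Cube n → ℝ} {δ r : Fin n → ℝ} (hδ : ∀ j ∈ S, ∀ x, |diff j F x| ≤ δ j)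
    (hr0 : ∀ j ∈ S, 0 ≤ r j) (hr : ∀ j ∈ S, δ j + ∑ l ∈ S, r l * M l j ≤ r j) (x : Cube n) :
    |cCov p S g F x| ≤ ∑ j ∈ S, r j * cE p S (fun y => var1 p j y * |diff j g y|) x := by
  rcases S.eq_empty_or_nonempty with rfl | hS
  · simp [cCov, cE_empty H.pos]
  have hG : ∀ y, |g y| ≤ ∑ z, |g z| := fun y =>
    Finset.single_le_sum (f := fun z => |g z|) (fun z _ => abs_nonneg _) (Finset.mem_univ y)
  have hm1 : (1 : ℝ) ≤ S.card := by exact_mod_cast hS.card_pos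
  have hρ0 : 0 ≤ 1 - (1 - α) / (S.card : ℝ) := by
    rw [sub_nonneg, div_le_one (by linarith)]
    linarith [H.alpha_nonneg]
  have hρ1 : 1 - (1 - α) / (S.card : ℝ) < 1 := by
    have : 0 < (1 - α) / (S.card : ℝ) := div_pos (by linarith [H.alpha_lt]) (by linarith)
    linarith
  have hlim := (((tendsto_pow_atTop_nhds_zero_of_lt_one hρ0 hρ1).mul_const
    (∑ j ∈ S, δ j)).const_mul (2 * ∑ z, |g z|)).const_add
    (∑ j ∈ S, r j * cE p S (fun y => var1 p j y * |diff j g y|) x)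
  rw [zero_mul, mul_zero, add_zero] at hlim
  exact ge_of_tendsto' hlim fun N => H.abs_cCov_le_iterate hS hG x N F δ r hδ hr0 hr

end WeaklyDependent

/-! ### Resolvents of restricted influence matrices -/

section Resolvent

open Matrix

/-- Minimum principle: a negative minimum would be strictly below its own weighted average, because
the row sums are at most `α < 1`. -/
lemma nonneg_of_fixed {ι : Type*} [Fintype ι] {N : ι → ι → ℝ} {α : ℝ} (hN : ∀ i j, 0 ≤ N i j)
    (hrow : ∀ i, ∑ j, N i j ≤ α) (hα : α < 1) {y b : ι → ℝ} (hb : ∀ i, 0 ≤ b i)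
    (hy : ∀ i, y i = b i + ∑ j, N i j * y j) (i : ι) : 0 ≤ y i := by
  obtain ⟨k, -, hk⟩ := Finset.exists_min_image Finset.univ y ⟨i, Finset.mem_univ i⟩
  have h1 : (∑ j, N k j) * y k ≤ ∑ j, N k j * y j := by
    rw [Finset.sum_mul]
    exact Finset.sum_le_sum fun j hj => mul_le_mul_of_nonneg_left (hk j hj) (hN _ _)
  have h2 : 0 ≤ y k := by
    by_contra! h
    have := hy k
    have := hb k
    have := hrow k
    nlinarith
  exact h2.trans (hk i (Finset.mem_univ i))

/-- The restriction of the matrix `M` to `S × S`. -/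
def restr (M : Fin n → Fin n → ℝ) (S : Finset (Fin n)) : Matrix (Fin n) (Fin n) ℝ :=
  Matrix.of fun i j => if i ∈ S ∧ j ∈ S then M i j else 0

/-- The resolvent `(1 - M_S)⁻¹` of the restriction of `M` to `S × S`. -/
noncomputable def resolv (M : Fin n → Fin n → ℝ) (S : Finset (Fin n)) :
    Matrix (Fin n) (Fin n) ℝ := (1 - restr M S)⁻¹

variable {M : Fin n → Fin n → ℝ} {α : ℝ} (hM : ∀ i j, 0 ≤ M i j) (hrow : ∀ i, ∑ j, M i j ≤ α)
  (hα : α < 1) (S : Finset (Fin n))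
include hM

lemma restr_nonneg (i j : Fin n) : 0 ≤ restr M S i j := by
  unfold restr
  simp only [Matrix.of_apply]
  split_ifs
  exacts [hM i j, le_rfl]

include hrow

lemma restr_row (i : Fin n) : ∑ j, restr M S i j ≤ α := by
  refine le_trans (Finset.sum_le_sum fun j _ => ?_) (hrow i)
  unfold restr
  simp only [Matrix.of_apply]
  split_ifs
  exacts [le_rfl, hM i j]

include hα

lemma fixed_unique {y z b : Fin n → ℝ} (hy : ∀ i, y i = b i + ∑ j, restr M S i j * y j)
    (hz : ∀ i, z i = b i + ∑ j, restr M S i j * z j) : y = z := by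
  have key : ∀ u v : Fin n → ℝ, (∀ i, u i = b i + ∑ j, restr M S i j * u j) →
      (∀ i, v i = b i + ∑ j, restr M S i j * v j) → ∀ i, 0 ≤ u i - v i := by
    intro u v hu hv
    refine nonneg_of_fixed (restr_nonneg hM S) (restr_row hM hrow S) hα (b := fun _ => 0)
      (fun _ => le_rfl) fun i => ?_
    rw [zero_add]
    simp only [mul_sub, Finset.sum_sub_distrib]
    linarith [hu i, hv i]
  funext i
  linarith [key y z hy hz i, key z y hz hy i]

lemma isUnit_one_sub_restr : IsUnit (1 - restr M S) := by
  rw [← Matrix.mulVec_injective_iff_isUnit]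
  intro y z h
  have e : ∀ u : Fin n → ℝ, ∀ i, u i = (1 - restr M S).mulVec u i + ∑ j, restr M S i j * u j := by
    intro u i
    rw [Matrix.sub_mulVec, Matrix.one_mulVec]
    simp [Matrix.mulVec, dotProduct]
  exact fixed_unique hM hrow hα S (e y) (fun i => by rw [h]; exact e z i)

lemma resolv_eq_left (i j : Fin n) :
    resolv M S i j = (if i = j then 1 else 0) + ∑ l, restr M S i l * resolv M S l j := by
  have h : (1 - restr M S) * resolv M S = 1 :=
    Matrix.mul_nonsing_inv _ ((Matrix.isUnit_iff_isUnit_det _).1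
      (isUnit_one_sub_restr hM hrow hα S))
  rw [sub_mul, one_mul, sub_eq_iff_eq_add] at h
  have := congrFun (congrFun h i) j
  rwa [Matrix.add_apply, Matrix.one_apply, Matrix.mul_apply] at this

lemma resolv_eq_right (i j : Fin n) :
    resolv M S i j = (if i = j then 1 else 0) + ∑ l, resolv M S i l * restr M S l j := by
  have h : resolv M S * (1 - restr M S) = 1 :=
    Matrix.nonsing_inv_mul _ ((Matrix.isUnit_iff_isUnit_det _).1
      (isUnit_one_sub_restr hM hrow hα S))
  rw [mul_sub, mul_one, sub_eq_iff_eq_add] at h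
  have := congrFun (congrFun h i) j
  rwa [Matrix.add_apply, Matrix.one_apply, Matrix.mul_apply] at this

lemma resolv_nonneg (i j : Fin n) : 0 ≤ resolv M S i j :=
  nonneg_of_fixed (restr_nonneg hM S) (restr_row hM hrow S) hα (y := fun i => resolv M S i j)
    (b := fun i => if i = j then 1 else 0) (fun i => by split_ifs <;> norm_num)
    (fun i => resolv_eq_left hM hrow hα S i j) i

/-- The defect of the row sums from `1 / (1 - α)` solves the fixed point equation with a nonnegative
source, so the minimum principle applies. -/
lemma resolv_row (i : Fin n) : ∑ j, resolv M S i j ≤ 1 / (1 - α) := by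
  have hα' : 0 < 1 - α := by linarith
  have := nonneg_of_fixed (restr_nonneg hM S) (restr_row hM hrow S) hα
    (y := fun i => 1 / (1 - α) - ∑ j, resolv M S i j)
    (b := fun i => (α - ∑ j, restr M S i j) / (1 - α))
    (fun i => div_nonneg (sub_nonneg.2 (restr_row hM hrow S i)) hα'.le) (fun i => ?_) i
  · exact sub_nonneg.1 this
  · have h : ∑ j, resolv M S i j = 1 + ∑ l, restr M S i l * ∑ j, resolv M S l j := by
      rw [Finset.sum_congr rfl fun j _ => resolv_eq_left hM hrow hα S i j,
        Finset.sum_add_distrib, Finset.sum_comm]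
      simp [Finset.mul_sum]
    simp only [mul_sub, Finset.sum_sub_distrib]
    rw [h, ← Finset.sum_mul]
    field_simp
    ring

/-- The row of the resolvent solves the equation exactly on `S`; passing to `S'` only drops
nonnegative terms. Hence one resolvent serves all subsets of `S`. -/
lemma resolv_supersolution {S' : Finset (Fin n)} (hS : S' ⊆ S) (i : Fin n) {j : Fin n}
    (hj : j ∈ S') : (if i = j then 1 else 0) + ∑ l ∈ S', resolv M S i l * M l j ≤
      resolv M S i j := by
  rw [resolv_eq_right hM hrow hα S i j]
  gcongr
  calc ∑ l ∈ S', resolv M S i l * M l j = ∑ l ∈ S', resolv M S i l * restr M S l j := by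
        refine Finset.sum_congr rfl fun l hl => ?_
        simp [restr, hS hl, hS hj]
    _ ≤ ∑ l, resolv M S i l * restr M S l j :=
        Finset.sum_le_univ_sum_of_nonneg fun l =>
          mul_nonneg (resolv_nonneg hM hrow hα S i l) (restr_nonneg hM S l j)

lemma resolv_eq_zero {i j : Fin n} (hi : i ∉ S) (hij : i ≠ j) : resolv M S i j = 0 := by
  rw [resolv_eq_left hM hrow hα, if_neg hij, zero_add]
  exact Finset.sum_eq_zero fun l _ => by simp [restr, hi]

/-- Column sums of the resolvent are controlled by those of the resolvent with one site removed. -/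
lemma resolv_col_le {j : Fin n} (hj : j ∉ S) :
    ∑ i, resolv M (insert j S) i j ≤
      1 / (1 - α) * (1 + ∑ i ∈ S, M i j * ∑ k, resolv M S k i) := by
  set R := resolv M (insert j S) with hR
  have hRn := resolv_nonneg hM hrow hα (insert j S)
  -- `y` is column `j` of `R` cut to `S`. It solves the fixed point equation on `S` with source `M i
  -- j * R j j`, so it equals `resolv M S` applied to that source.
  set y : Fin n → ℝ := fun i => if i ∈ S then R i j else 0 with hy
  set b : Fin n → ℝ := fun i => if i ∈ S then M i j * R j j else 0 with hb
  have h1 : ∀ i, y i = b i + ∑ l, restr M S i l * y l := by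
    intro i
    by_cases hi : i ∈ S
    · have hij : i ≠ j := fun e => hj (e ▸ hi)
      simp only [hy, hb, if_pos hi]
      rw [hR, resolv_eq_left hM hrow hα, if_neg hij, zero_add, ← hR]
      rw [← Finset.add_sum_erase _ (fun l => restr M (insert j S) i l * R l j)
          (Finset.mem_univ j),
        ← Finset.add_sum_erase _ (fun l => restr M S i l * if l ∈ S then R l j else 0)
          (Finset.mem_univ j)]
      simp only [if_neg hj, mul_zero, zero_add]
      congr 1
      · simp [restr, hi]
      · refine Finset.sum_congr rfl fun l hl => ?_
        have hl' := Finset.ne_of_mem_erase hl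
        by_cases h : l ∈ S <;> simp [restr, hi, h, hl']
    · simp only [hy, hb, if_neg hi]
      rw [Finset.sum_eq_zero fun l _ => by simp [restr, hi]]
      simp
  have h2 : ∀ i, ∑ l, resolv M S i l * b l = b i + ∑ k, restr M S i k * ∑ l, resolv M S k l * b l := by
    intro i
    rw [Finset.sum_congr rfl fun l _ => by rw [resolv_eq_left hM hrow hα S i l]]
    simp only [add_mul, Finset.sum_add_distrib, Finset.sum_mul, Finset.mul_sum]
    rw [Finset.sum_comm]
    simp [mul_assoc]
  have h3 : y = fun i => ∑ l, resolv M S i l * b l := fixed_unique hM hrow hα S h1 h2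
  have h4 : ∑ i, R i j = R j j + ∑ i, y i := by
    rw [← Finset.add_sum_erase _ (fun i => R i j) (Finset.mem_univ j),
      ← Finset.add_sum_erase _ y (Finset.mem_univ j)]
    have : y j = 0 := by simp [hy, hj]
    rw [this, zero_add]
    congr 1
    refine Finset.sum_congr rfl fun i hi => ?_
    have hij := Finset.ne_of_mem_erase hi
    by_cases h : i ∈ S
    · simp [hy, h]
    · simp only [hy, if_neg h]
      exact resolv_eq_zero hM hrow hα _ (by simp [h, hij]) hij
  have h5 : ∑ i, y i = R j j * ∑ i ∈ S, M i j * ∑ k, resolv M S k i := by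
    rw [h3, Finset.sum_comm, Finset.mul_sum]
    rw [← Finset.sum_subset (Finset.subset_univ S)]
    · refine Finset.sum_congr rfl fun l hl => ?_
      rw [← Finset.sum_mul]
      simp only [hb, if_pos hl]
      ring
    · intro l _ hl
      simp [hb, hl]
  have h6 : R j j ≤ 1 / (1 - α) :=
    (Finset.single_le_sum (f := fun k => R j k) (fun k _ => hRn j k) (Finset.mem_univ j)).trans
      (resolv_row hM hrow hα _ j)
  have h7 : 0 ≤ ∑ i ∈ S, M i j * ∑ k, resolv M S k i :=
    Finset.sum_nonneg fun i _ => mul_nonneg (hM i j)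
      (Finset.sum_nonneg fun k _ => resolv_nonneg hM hrow hα S k i)
  rw [h4, h5]
  calc R j j + R j j * ∑ i ∈ S, M i j * ∑ k, resolv M S k i
      = R j j * (1 + ∑ i ∈ S, M i j * ∑ k, resolv M S k i) := by ring
    _ ≤ _ := mul_le_mul_of_nonneg_right h6 (by linarith)

end Resolvent


/-! ### Conditional entropy and two-point inequalities -/

/-- The conditional entropy of `g` given the coordinates off `S`. -/
noncomputable def cEnt (p : Cube n → ℝ) (S : Finset (Fin n)) (g : Cube n → ℝ) (x : Cube n) : ℝ :=
  cE p S (fun y => g y * Real.log (g y)) x - cE p S g x * Real.log (cE p S g x)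

/-- Entropy is at most variance over mean, by `log v ≤ v - 1` at each atom. -/
lemma two_point_ent_le {a s t m : ℝ} (ha0 : 0 ≤ a) (ha1 : a ≤ 1) (hs : 0 < s) (ht : 0 < t)
    (hm0 : 0 < m) (hm : m = a * s + (1 - a) * t) :
    a * (s * Real.log s) + (1 - a) * (t * Real.log t) - m * Real.log m ≤
      a * (1 - a) * (s - t) ^ 2 / m := by
  have key : ∀ u : ℝ, 0 < u → u * Real.log u - u * Real.log m ≤ u * (u / m - 1) := by
    intro u hu
    rw [← mul_sub, ← Real.log_div hu.ne' hm0.ne']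
    exact mul_le_mul_of_nonneg_left (Real.log_le_sub_one_of_pos (div_pos hu hm0)) hu.le
  have h1 := mul_le_mul_of_nonneg_left (key s hs) ha0
  have h2 := mul_le_mul_of_nonneg_left (key t ht) (sub_nonneg.2 ha1)
  have h3 : a * (s * (s / m - 1)) + (1 - a) * (t * (t / m - 1)) =
      a * (1 - a) * (s - t) ^ 2 / m := by
    field_simp
    rw [hm]
    ring
  rw [← h3]
  have : m * Real.log m = a * (s * Real.log m) + (1 - a) * (t * Real.log m) := by
    rw [hm]; ring
  linarith

/-- With `w = √z` one has `z log z - z + 1 ≥ (w - 1) ^ 2`, and `(z - 1) ^ 2 = (w - 1) ^ 2 * (w + 1)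
^ 2`. The bounds on `a` and `a * z` give `a * (w + 1) ^ 2 ≤ 4`. -/
lemma sq_le_mul_log {a z : ℝ} (ha0 : 0 ≤ a) (ha1 : a ≤ 1) (hz : 0 < z) (haz : a * z ≤ 1) :
    (a * (z - 1)) ^ 2 / 4 ≤ a * (z * Real.log z - z + 1) := by
  obtain ⟨w, hw, rfl⟩ : ∃ w : ℝ, 0 < w ∧ z = w ^ 2 :=
    ⟨√z, Real.sqrt_pos.2 hz, (Real.sq_sqrt hz.le).symm⟩
  have h1 : w ^ 2 - w ≤ w ^ 2 * Real.log w := by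
    have h := Real.one_sub_inv_le_log_of_pos hw
    have := mul_le_mul_of_nonneg_left h (sq_nonneg w)
    have e : w ^ 2 * (1 - w⁻¹) = w ^ 2 - w := by field_simp
    linarith
  have h2 : a * (w - 1) ^ 2 ≤ a * (w ^ 2 * Real.log (w ^ 2) - w ^ 2 + 1) := by
    refine mul_le_mul_of_nonneg_left ?_ ha0
    rw [Real.log_pow]
    push_cast
    nlinarith
  refine le_trans ?_ h2
  have h3 : a * (w + 1) ^ 2 ≤ 4 := by nlinarith [mul_nonneg ha0 (sq_nonneg (w - 1))]
  have h4 : 0 ≤ a * (w - 1) ^ 2 := mul_nonneg ha0 (sq_nonneg _)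
  nlinarith [mul_le_mul_of_nonneg_left h3 h4]

/-- A Pinsker inequality, obtained by adding `sq_le_mul_log` at the two atoms normalized by the
mean. -/
lemma le_two_point_ent {a s t m : ℝ} (ha0 : 0 ≤ a) (ha1 : a ≤ 1) (hs : 0 < s) (ht : 0 < t)
    (hm0 : 0 < m) (hm : m = a * s + (1 - a) * t) :
    (a * (1 - a) * (s - t)) ^ 2 / (2 * m) ≤
      a * (s * Real.log s) + (1 - a) * (t * Real.log t) - m * Real.log m := by
  have hb0 : 0 ≤ 1 - a := sub_nonneg.2 ha1
  have h1 := sq_le_mul_log (z := s / m) ha0 ha1 (div_pos hs hm0) (by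
    rw [← mul_div_assoc, div_le_one hm0, hm]; nlinarith)
  have h2 := sq_le_mul_log (z := t / m) hb0 (by linarith) (div_pos ht hm0) (by
    rw [← mul_div_assoc, div_le_one hm0, hm]; nlinarith)
  rw [Real.log_div hs.ne' hm0.ne'] at h1
  rw [Real.log_div ht.ne' hm0.ne'] at h2
  have h3 := mul_le_mul_of_nonneg_left (add_le_add h1 h2) hm0.le
  have e1 : s / m - 1 = (1 - a) * (s - t) / m := by
    rw [div_sub_one hm0.ne']; congr 1; rw [hm]; ring
  have e2 : t / m - 1 = -(a * (s - t) / m) := by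
    rw [div_sub_one hm0.ne', ← neg_div]; congr 1; rw [hm]; ring
  rw [e1, e2] at h3
  have e3 : m * ((a * ((1 - a) * (s - t) / m)) ^ 2 / 4 + ((1 - a) * -(a * (s - t) / m)) ^ 2 / 4) =
      (a * (1 - a) * (s - t)) ^ 2 / (2 * m) := by
    field_simp
    ring
  have e4 : m * (a * (s / m * (Real.log s - Real.log m) - s / m + 1) +
      (1 - a) * (t / m * (Real.log t - Real.log m) - t / m + 1)) =
      a * (s * Real.log s) + (1 - a) * (t * Real.log t) - m * Real.log m := by
    have : m * Real.log m = (a * s + (1 - a) * t) * Real.log m := by rw [← hm]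
    rw [this]
    field_simp
    linear_combination (1 : ℝ) * hm
  rwa [e3, e4] at h3

section
variable {p : Cube n → ℝ} (hp : ∀ x, 0 < p x) {S T : Finset (Fin n)} {x : Cube n}
  {g : Cube n → ℝ}
include hp

lemma cEnt_chain (hST : S ⊆ T) (g : Cube n → ℝ) :
    cEnt p T g x = cE p T (cEnt p S g) x + cEnt p T (cE p S g) x := by
  have : cE p T (cEnt p S g) x = cE p T (fun y => g y * Real.log (g y)) x -
      cE p T (fun y => cE p S g y * Real.log (cE p S g y)) x := by
    rw [← cE_cE hp hST (fun y => g y * Real.log (g y)), ← cE_sub]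
    rfl
  rw [this]
  unfold cEnt
  rw [cE_cE hp hST]
  ring

lemma cEnt_nonneg (hg : ∀ y, 0 < g y) : 0 ≤ cEnt p S g x := by
  have hm := cE_pos hp (S := S) (x := x) hg
  set m := cE p S g x with hm_def
  have h := cE_mono hp (S := S) (x := x) (g := fun y => Real.log m * g y + (g y - m))
    (h := fun y => g y * Real.log (g y)) fun y _ => by
      have := Real.one_sub_inv_le_log_of_pos (div_pos (hg y) hm)
      rw [Real.log_div (hg y).ne' hm.ne', inv_div] at this
      have := mul_le_mul_of_nonneg_left this (hg y).le
      have e : g y * (1 - m / g y) = g y - m := by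
        have := (hg y).ne'
        field_simp
      linarith
  rw [cE_add, cE_smul, cE_sub, cE_const hp, ← hm_def] at h
  unfold cEnt
  rw [← hm_def]
  linarith

/-- Once averaged over `S.erase k`, `g` depends on `x k` alone and its entropy is that of a
two-point law. The upper bound converts entropy into covariance, the lower bound the reverse. -/
lemma cEnt_two_point {k : Fin n} (hk : k ∈ S) (hg : ∀ y, 0 < g y) :
    cEnt p S (cE p (S.erase k) g) x ≤ cE p S (up k) x * (1 - cE p S (up k) x) *
        diff k (cE p (S.erase k) g) x ^ 2 / cE p S g x ∧
    cCov p S g (up k) x ^ 2 / (2 * cE p S g x) ≤ cEnt p S (cE p (S.erase k) g) x := by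
  have hsub : S.erase k ⊆ S := Finset.erase_subset _ _
  have ha : ∀ y z, z ∈ fiber (S.erase k) y → cE p (S.erase k) g z = cE p (S.erase k) g y :=
    fun y z h => cE_agree g h
  have hm := cE_pos hp (S := S) (x := x) hg
  have h0 := cE_pos hp (S := S.erase k) (x := Function.update x k 1) hg
  have h1 := cE_pos hp (S := S.erase k) (x := Function.update x k (-1)) hg
  have hu := cE_up_mem hp (S := S) (x := x) (k := k)
  have e1 := cE_two_point hp hk (x := x) ha
  rw [cE_cE hp hsub] at e1
  rw [cCov_up_eq hp hk]
  unfold cEnt diff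
  rw [cE_two_point hp hk (φ := fun y => cE p (S.erase k) g y * Real.log (cE p (S.erase k) g y))
    (fun y z h => by rw [ha y z h]), cE_cE hp hsub]
  exact ⟨two_point_ent_le hu.1 hu.2 h0 h1 hm e1, le_two_point_ent hu.1 hu.2 h0 h1 hm e1⟩

lemma cE_sq_nonneg_sub (h : Cube n → ℝ) : 0 ≤ cCov p S h h x := by
  have := cE_sq_le hp (S := S) (x := x) (u := h) (v := fun _ => 1) (fun _ => one_pos)
  rw [cE_const hp, mul_one] at this
  unfold cCov
  have e : cE p S (fun y => h y ^ 2 / 1) x = cE p S (fun y => h y * h y) x :=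
    cE_congr fun y _ => by ring
  rw [e] at this
  linarith [sq (cE p S h x)]

/-- The law of total variance: the mean local variance is at most the variance given the coordinates
off `S`. -/
lemma cE_var1_le {k : Fin n} (hk : k ∈ S) :
    cE p S (var1 p k) x ≤ cE p S (up k) x * (1 - cE p S (up k) x) := by
  rw [← cCov_up_up hp hk, cCov_chain hp (Finset.singleton_subset_iff.2 hk)]
  have : cE p S (cCov p {k} (up k) (up k)) x = cE p S (var1 p k) x :=
    cE_congr fun y _ => by rw [cCov_singleton hp, diff_up]; simp
  rw [this]
  linarith [cE_sq_nonneg_sub hp (S := S) (x := x) (cE p {k} (up k))]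

omit hp in
lemma sq_add_le {X Y a b c d : ℝ} (hX : X ^ 2 ≤ a * b) (hY : Y ^ 2 ≤ c * d) (ha : 0 ≤ a)
    (hb : 0 ≤ b) (hc : 0 ≤ c) (hd : 0 ≤ d) : (X + Y) ^ 2 ≤ (a + c) * (b + d) := by
  have h1 : (2 * (X * Y)) ^ 2 ≤ (a * d + c * b) ^ 2 := by
    have := mul_le_mul hX hY (sq_nonneg _) (mul_nonneg ha hb)
    nlinarith [sq_nonneg (a * d - c * b)]
  have h2 := (le_abs_self _).trans
    (abs_le_of_sq_le_sq h1 (add_nonneg (mul_nonneg ha hd) (mul_nonneg hc hb)))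
  nlinarith

/-- A covariance bound by the entropy, for functions with bounded martingale increments. -/
lemma cCov_sq_le_cEnt (hg : ∀ y, 0 < g y) {F : Cube n → ℝ} {q : Fin n → ℝ} (hq : ∀ k, 0 ≤ q k)
    (hF : ∀ (S : Finset (Fin n)) (k : Fin n), k ∈ S → ∀ x,
      diff k (cE p (S.erase k) F) x ^ 2 ≤ q k) :
    ∀ x, cCov p S g F x ^ 2 ≤ 2 * cE p S g x * ((∑ k ∈ S, q k) * cEnt p S g x) := by
  induction S using Finset.induction_on with
  | empty =>
    intro x
    simp [cCov, cE_empty hp]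
  | insert k S hk ih =>
    intro x
    have hsub : S ⊆ insert k S := Finset.subset_insert _ _
    have her : (insert k S).erase k = S := Finset.erase_insert hk
    have hmem : k ∈ insert k S := Finset.mem_insert_self _ _
    -- Reveal coordinate `k`. The averaged inner covariance is handled by induction and
    -- Cauchy–Schwarz, the increment by Pinsker, and `sq_add_le` adds the two bounds in step with
    -- the entropy chain rule.
    rw [cCov_chain hp hsub, Finset.sum_insert hk, cEnt_chain hp hsub]
    set m := cE p (insert k S) g x with hm_def
    have hm : 0 < m := cE_pos hp hg
    have h1 : cE p (insert k S) (cCov p S g F) x ^ 2 ≤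
        (2 * m * ∑ k ∈ S, q k) * cE p (insert k S) (cEnt p S g) x := by
      have hcs := cE_sq_le hp (S := insert k S) (x := x) (u := cCov p S g F) (v := cE p S g)
        fun y => cE_pos hp hg
      rw [cE_cE hp hsub, ← hm_def] at hcs
      have : cE p (insert k S) (fun y => cCov p S g F y ^ 2 / cE p S g y) x ≤
          (2 * ∑ k ∈ S, q k) * cE p (insert k S) (cEnt p S g) x := by
        rw [← cE_smul]
        refine cE_mono hp fun y _ => ?_
        rw [div_le_iff₀ (cE_pos hp hg)]
        calc _ ≤ _ := ih y
          _ = _ := by ring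
      calc _ ≤ _ := hcs
        _ ≤ (2 * ∑ k ∈ S, q k) * cE p (insert k S) (cEnt p S g) x * m := by gcongr
        _ = _ := by ring
    have h2 : cCov p (insert k S) (cE p S g) (cE p S F) x ^ 2 ≤
        (2 * m * q k) * cEnt p (insert k S) (cE p S g) x := by
      have hl := (cEnt_two_point hp hmem hg (x := x)).2
      rw [cCov_up_eq hp hmem, her, ← hm_def, div_le_iff₀ (by positivity)] at hl
      rw [cCov_two_point hp hmem (fun y z h => cE_agree g (her ▸ h))
        (fun y z h => cE_agree F (her ▸ h))]
      have hFk := hF _ k hmem x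
      rw [her] at hFk
      rw [← mul_assoc, mul_pow]
      calc _ ≤ cEnt p (insert k S) (cE p S g) x * (2 * m) * q k :=
            mul_le_mul hl hFk (sq_nonneg _) (le_trans (sq_nonneg _) hl)
        _ = _ := by ring
    have hQ : 0 ≤ ∑ k ∈ S, q k := Finset.sum_nonneg fun k _ => hq k
    have := sq_add_le h1 h2 (by positivity)
      (cE_nonneg hp fun y => cEnt_nonneg hp hg) (mul_nonneg (by positivity) (hq k))
      (cEnt_nonneg hp fun y => cE_pos hp hg)
    calc _ ≤ _ := this
      _ = _ := by ring

end

lemma sq_sum_mul_le {ι : Type*} (A : Finset ι) {w b : ι → ℝ} (hw : ∀ i ∈ A, 0 ≤ w i) :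
    (∑ i ∈ A, w i * b i) ^ 2 ≤ (∑ i ∈ A, w i) * ∑ i ∈ A, w i * b i ^ 2 :=
  Finset.sum_sq_le_sum_mul_sum_of_sq_le_mul _ hw
    (fun i hi => mul_nonneg (hw i hi) (sq_nonneg _)) fun i _ => le_of_eq (by ring)

/-! ### Entropic independence -/

namespace WeaklyDependent

variable {p : Cube n → ℝ} {M : Fin n → Fin n → ℝ} {α κ γ : ℝ} (H : WeaklyDependent p M α κ γ)
  {S : Finset (Fin n)} {g : Cube n → ℝ}
include H

lemma half_gamma_le_var1 (k : Fin n) (x : Cube n) : γ / 2 ≤ var1 p k x := by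
  unfold var1
  nlinarith [H.le_cond k x, H.cond_le k x, H.gamma_pos, H.gamma_le]

lemma half_gamma_le_var {k : Fin n} (hk : k ∈ S) (x : Cube n) :
    γ / 2 ≤ cE p S (up k) x * (1 - cE p S (up k) x) := by
  refine le_trans ?_ (cE_var1_le H.pos hk)
  rw [← cE_const H.pos (S := S) (x := x) (γ / 2)]
  exact cE_mono H.pos fun y _ => H.half_gamma_le_var1 k y

/-- The function `up i` oscillates only at `i`, so row `i` of the resolvent is an admissible
supersolution. -/
lemma abs_cCov_up_le {S' : Finset (Fin n)} (hS : S ⊆ S') (g : Cube n → ℝ) (i : Fin n)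
    (x : Cube n) : |cCov p S g (up i) x| ≤
      ∑ j ∈ S, resolv M S' i j * cE p S (fun y => var1 p j y * |diff j g y|) x := by
  refine H.abs_cCov_le (δ := fun j => if i = j then 1 else 0) (fun j _ y => ?_)
    (fun j _ => resolv_nonneg H.nonneg H.row H.alpha_lt S' i j)
    (fun j hj => resolv_supersolution H.nonneg H.row H.alpha_lt S' hS i hj) x
  rw [diff_up]
  split_ifs <;> simp

lemma abs_cCov_up_up_le {k : Fin n} (hk : k ∈ S) (i : Fin n) (x : Cube n) :
    |cCov p S (up k) (up i) x| ≤ resolv M Finset.univ i k * cE p S (var1 p k) x := by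
  refine (H.abs_cCov_up_le (Finset.subset_univ S) (up k) i x).trans (le_of_eq ?_)
  rw [Finset.sum_eq_single_of_mem k hk]
  · congr 1
    exact cE_congr fun y _ => by rw [diff_up, if_pos rfl, abs_one, mul_one]
  · intro j _ hj
    have : cE p S (fun y => var1 p j y * |diff j (up k) y|) x = 0 := by
      rw [← cE_const H.pos (S := S) (x := x) 0]
      exact cE_congr fun y _ => by rw [diff_up, if_neg hj.symm, abs_zero, mul_zero]
    rw [this, mul_zero]

/-- Marginal entropies are controlled by the local energies. -/
lemma cCov_up_sq_div_le {S' : Finset (Fin n)} (hS : S ⊆ S') (hg : ∀ y, 0 < g y) (i : Fin n)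
    (x : Cube n) : cCov p S g (up i) x ^ 2 / cE p S g x ≤ 1 / (1 - α) *
      ∑ j ∈ S, resolv M S' i j *
        cE p S (fun y => (var1 p j y * |diff j g y|) ^ 2 / cE p {j} g y) x := by
  have hR := resolv_nonneg H.nonneg H.row H.alpha_lt S' i
  have hm := cE_pos H.pos (S := S) (x := x) hg
  rw [div_le_iff₀ hm, ← sq_abs]
  have hrow : ∑ j ∈ S, resolv M S' i j ≤ 1 / (1 - α) :=
    (Finset.sum_le_univ_sum_of_nonneg hR).trans (resolv_row H.nonneg H.row H.alpha_lt S' i)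
  have h1 : ∑ j ∈ S, resolv M S' i j * cE p S (fun y => var1 p j y * |diff j g y|) x ^ 2 ≤
      (∑ j ∈ S, resolv M S' i j *
        cE p S (fun y => (var1 p j y * |diff j g y|) ^ 2 / cE p {j} g y) x) * cE p S g x := by
    rw [Finset.sum_mul]
    refine Finset.sum_le_sum fun j hj => ?_
    rw [mul_assoc]
    refine mul_le_mul_of_nonneg_left ?_ (hR j)
    have := cE_sq_le H.pos (S := S) (x := x) (u := fun y => var1 p j y * |diff j g y|)
      (v := cE p {j} g) fun y => cE_pos H.pos hg
    rwa [cE_cE H.pos (Finset.singleton_subset_iff.2 hj)] at this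
  calc |cCov p S g (up i) x| ^ 2
      ≤ (∑ j ∈ S, resolv M S' i j * cE p S (fun y => var1 p j y * |diff j g y|) x) ^ 2 := by
        gcongr
        exact H.abs_cCov_up_le hS g i x
    _ ≤ (∑ j ∈ S, resolv M S' i j) *
        ∑ j ∈ S, resolv M S' i j * cE p S (fun y => var1 p j y * |diff j g y|) x ^ 2 :=
        sq_sum_mul_le _ fun j _ => hR j
    _ ≤ 1 / (1 - α) * ((∑ j ∈ S, resolv M S' i j *
        cE p S (fun y => (var1 p j y * |diff j g y|) ^ 2 / cE p {j} g y) x) * cE p S g x) :=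
        mul_le_mul hrow h1 (Finset.sum_nonneg fun j _ => mul_nonneg (hR j) (sq_nonneg _))
          (one_div_nonneg.2 (by linarith [H.alpha_lt]))
    _ = _ := by ring

/-- The loss is the entropy of a two-point function, at most `V d ^ 2` over the mean, where `V` is
the variance of `up i` and `d` the difference. As `V ≥ γ / 2`, a further factor `V` may be inserted,
giving the squared covariance `(V d) ^ 2`. -/
lemma cEnt_sub_le {i : Fin n} (hi : i ∈ S) (hg : ∀ y, 0 < g y) (x : Cube n) :
    cEnt p S g x - cE p S (cEnt p (S.erase i) g) x ≤
      2 / γ * (cCov p S g (up i) x ^ 2 / cE p S g x) := by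
  rw [cEnt_chain H.pos (Finset.erase_subset i S), add_sub_cancel_left]
  refine (cEnt_two_point H.pos hi hg).1.trans ?_
  rw [cCov_up_eq H.pos hi, ← mul_div_assoc]
  have hm := cE_pos H.pos (S := S) (x := x) hg
  refine div_le_div_of_nonneg_right ?_ hm.le
  have hV := H.half_gamma_le_var hi x
  set V := cE p S (up i) x * (1 - cE p S (up i) x)
  have hγ := H.gamma_pos
  have hV0 : 0 ≤ V := by linarith
  have h1 : 1 ≤ 2 / γ * V := by
    rw [div_mul_eq_mul_div, le_div_iff₀ hγ]
    linarith
  have := mul_le_mul_of_nonneg_right h1 (mul_nonneg hV0 (sq_nonneg (diff i (cE p (S.erase i) g) x)))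
  linarith [this]

/-- Entropic independence: the squared covariances with the coordinates are controlled by the
entropy. -/
lemma sum_cCov_up_sq_le (hg : ∀ y, 0 < g y) (x : Cube n) :
    ∑ i ∈ S, cCov p S g (up i) x ^ 2 ≤ 1 / (γ * (1 - α) ^ 2) * (cE p S g x * cEnt p S g x) := by
  -- Duality: the covariance of `g` with `∑ i ∈ S, u i * up i` is `∑ i ∈ S, u i ^ 2`. It remains to
  -- bound the martingale increments of this linear function and use `cCov_sq_le_cEnt`.
  set u : Fin n → ℝ := fun i => cCov p S g (up i) x with hu
  have hα : 0 < 1 - α := by linarith [H.alpha_lt]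
  have hγ := H.gamma_pos
  set R := resolv M (Finset.univ : Finset (Fin n)) with hR_def
  have hR := resolv_nonneg H.nonneg H.row H.alpha_lt (Finset.univ : Finset (Fin n))
  have hrow := resolv_row H.nonneg H.row H.alpha_lt (Finset.univ : Finset (Fin n))
  rw [← hR_def] at hR hrow
  set q : Fin n → ℝ := fun k => 1 / (2 * γ * (1 - α)) * ∑ i ∈ S, R i k * u i ^ 2 with hq
  have hq0 : ∀ k, 0 ≤ q k := fun k => mul_nonneg (by positivity)
    (Finset.sum_nonneg fun i _ => mul_nonneg (hR i k) (sq_nonneg _))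
  have hF : ∀ (S' : Finset (Fin n)) (k : Fin n), k ∈ S' → ∀ y,
      diff k (cE p (S'.erase k) fun z => ∑ i ∈ S, u i * up i z) y ^ 2 ≤ q k := by
    intro S' k hk y
    set V := cE p S' (up k) y * (1 - cE p S' (up k) y) with hV_def
    have hV : γ / 2 ≤ V := H.half_gamma_le_var hk y
    have hV0 : 0 < V := by linarith
    -- Symmetry of the covariance bounds `c i` both by `R i k` and by a multiple of `R k i`. Using
    -- the latter for `∑ c i` and the former for the weights of `u i ^ 2`, all later sums are row
    -- sums of `R`.
    set c : Fin n → ℝ := fun i => |cCov p S' (up k) (up i) y| / V with hc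
    have hc0 : ∀ i, 0 ≤ c i := fun i => div_nonneg (abs_nonneg _) hV0.le
    have hc1 : ∀ i, c i ≤ R i k := by
      intro i
      rw [hc, div_le_iff₀ hV0]
      exact (H.abs_cCov_up_up_le hk i y).trans
        (mul_le_mul_of_nonneg_left (cE_var1_le H.pos hk) (hR i k))
    have hc2 : ∀ i, c i ≤ 1 / (2 * γ) * R k i := by
      intro i
      rw [hc, div_le_iff₀ hV0]
      have hb : |cCov p S' (up k) (up i) y| ≤ R k i * (1 / 4) := by
        rw [cCov_comm]
        by_cases hi : i ∈ S'
        · refine (H.abs_cCov_up_up_le hi k y).trans (mul_le_mul_of_nonneg_left ?_ (hR k i))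
          rw [← cE_const H.pos (S := S') (x := y) (1 / 4)]
          exact cE_mono H.pos fun z _ => var1_le i z
        · have h0 : cCov p S' (up i) (up k) y = 0 := by
            unfold cCov
            rw [cE_mul_of_const (h := up i) (g := up k) (fun z hz => up_agree hi y z hz)]
            have : cE p S' (up i) y = up i y := by
              rw [← cE_const H.pos (S := S') (x := y) (up i y)]
              exact cE_congr fun z hz => up_agree hi y z hz
            rw [this, sub_self]
          rw [h0, abs_zero]
          exact mul_nonneg (hR k i) (by norm_num)
      refine hb.trans ?_
      calc R k i * (1 / 4) = 1 / (2 * γ) * R k i * (γ / 2) := by field_simp; ring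
        _ ≤ _ := mul_le_mul_of_nonneg_left hV (mul_nonneg (by positivity) (hR k i))
    have hd : |diff k (cE p (S'.erase k) fun z => ∑ i ∈ S, u i * up i z) y| ≤
        ∑ i ∈ S, c i * |u i| := by
      have h := cCov_up_eq H.pos hk (fun z => ∑ i ∈ S, u i * up i z) (x := y)
      rw [cCov_comm, cCov_sum, ← hV_def] at h
      have h2 : diff k (cE p (S'.erase k) fun z => ∑ i ∈ S, u i * up i z) y =
          (∑ i ∈ S, u i * cCov p S' (up k) (up i) y) / V := by
        rw [h]; field_simp
      rw [h2, abs_div, abs_of_pos hV0, div_le_iff₀ hV0, Finset.sum_mul]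
      refine (Finset.abs_sum_le_sum_abs _ _).trans (le_of_eq (Finset.sum_congr rfl fun i _ => ?_))
      simp only [hc]
      rw [abs_mul]
      field_simp
    rw [← sq_abs]
    calc _ ≤ (∑ i ∈ S, c i * |u i|) ^ 2 := by gcongr
      _ ≤ (∑ i ∈ S, c i) * ∑ i ∈ S, c i * |u i| ^ 2 := sq_sum_mul_le _ fun i _ => hc0 i
      _ ≤ (1 / (2 * γ) * (1 / (1 - α))) * ∑ i ∈ S, R i k * u i ^ 2 := by
          refine mul_le_mul ?_ (Finset.sum_le_sum fun i _ => ?_)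
            (Finset.sum_nonneg fun i _ => mul_nonneg (hc0 i) (sq_nonneg _)) (by positivity)
          · refine (Finset.sum_le_sum fun i _ => hc2 i).trans ?_
            rw [← Finset.mul_sum]
            refine mul_le_mul_of_nonneg_left ?_ (by positivity)
            exact (Finset.sum_le_univ_sum_of_nonneg (hR k)).trans (hrow k)
          · rw [sq_abs]
            exact mul_le_mul_of_nonneg_right (hc1 i) (sq_nonneg _)
      _ = q k := by simp only [hq]; field_simp
  have hmain := cCov_sq_le_cEnt H.pos hg hq0 hF (S := S) x
  have hm := cE_pos H.pos (S := S) (x := x) hg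
  have he := cEnt_nonneg H.pos (S := S) (x := x) hg
  set U := ∑ i ∈ S, u i ^ 2 with hU
  have hU0 : 0 ≤ U := Finset.sum_nonneg fun i _ => sq_nonneg _
  have hcov : cCov p S g (fun z => ∑ i ∈ S, u i * up i z) x = U := by
    rw [cCov_sum, hU]
    exact Finset.sum_congr rfl fun i _ => by simp only [hu]; ring
  have hqs : ∑ k ∈ S, q k ≤ 1 / (2 * γ * (1 - α) ^ 2) * U := by
    simp only [hq]
    rw [← Finset.mul_sum, Finset.sum_comm]
    have : ∑ i ∈ S, ∑ k ∈ S, R i k * u i ^ 2 ≤ 1 / (1 - α) * U := by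
      rw [hU, Finset.mul_sum]
      refine Finset.sum_le_sum fun i _ => ?_
      rw [← Finset.sum_mul]
      refine mul_le_mul_of_nonneg_right ?_ (sq_nonneg _)
      exact (Finset.sum_le_univ_sum_of_nonneg (hR i)).trans (hrow i)
    calc _ ≤ 1 / (2 * γ * (1 - α)) * (1 / (1 - α) * U) :=
          mul_le_mul_of_nonneg_left this (by positivity)
      _ = _ := by field_simp
  rw [hcov] at hmain
  have h2 : U ^ 2 ≤ U * (1 / (γ * (1 - α) ^ 2) * (cE p S g x * cEnt p S g x)) := by
    calc U ^ 2 ≤ _ := hmain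
      _ ≤ 2 * cE p S g x * ((1 / (2 * γ * (1 - α) ^ 2) * U) * cEnt p S g x) := by gcongr
      _ = _ := by field_simp
  rcases hU0.eq_or_lt with h | h
  · rw [← h]; positivity
  · rw [sq] at h2
    exact le_of_mul_le_mul_left h2 h

end WeaklyDependent

/-! ### Random subsets of given density -/

section Bernoulli

variable {ι : Type*}

/-- The expectation of `φ S` for a random subset `S` of `Q` that contains each element independently
with probability `θ`. -/
def bern (θ : ℝ) (Q : Finset ι) (φ : Finset ι → ℝ) : ℝ :=
  ∑ S ∈ Q.powerset, θ ^ S.card * (1 - θ) ^ (Q.card - S.card) * φ S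

lemma bern_empty (θ : ℝ) (φ : Finset ι → ℝ) : bern θ ∅ φ = φ ∅ := by simp [bern]

lemma bern_congr (θ : ℝ) {Q : Finset ι} {φ ψ : Finset ι → ℝ} (h : ∀ S ⊆ Q, φ S = ψ S) :
    bern θ Q φ = bern θ Q ψ :=
  Finset.sum_congr rfl fun S hS => by rw [h S (Finset.mem_powerset.1 hS)]

lemma bern_mono {θ : ℝ} (h0 : 0 ≤ θ) (h1 : θ ≤ 1) {Q : Finset ι} {φ ψ : Finset ι → ℝ}
    (h : ∀ S ⊆ Q, φ S ≤ ψ S) : bern θ Q φ ≤ bern θ Q ψ :=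
  Finset.sum_le_sum fun S hS => mul_le_mul_of_nonneg_left (h S (Finset.mem_powerset.1 hS))
    (mul_nonneg (pow_nonneg h0 _) (pow_nonneg (sub_nonneg.2 h1) _))

lemma bern_add (θ : ℝ) (Q : Finset ι) (φ ψ : Finset ι → ℝ) :
    bern θ Q (fun S => φ S + ψ S) = bern θ Q φ + bern θ Q ψ := by
  simp [bern, mul_add, Finset.sum_add_distrib]

lemma bern_smul (θ c : ℝ) (Q : Finset ι) (φ : Finset ι → ℝ) :
    bern θ Q (fun S => c * φ S) = c * bern θ Q φ := by
  unfold bern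
  rw [Finset.mul_sum]
  exact Finset.sum_congr rfl fun S _ => by ring

lemma bern_sum {κ : Type*} (θ : ℝ) (Q : Finset ι) (A : Finset κ) (φ : κ → Finset ι → ℝ) :
    bern θ Q (fun S => ∑ i ∈ A, φ i S) = ∑ i ∈ A, bern θ Q (φ i) := by
  unfold bern
  rw [Finset.sum_comm]
  simp only [Finset.mul_sum]

variable [DecidableEq ι]

lemma bern_insert (θ : ℝ) {Q : Finset ι} {i : ι} (hi : i ∉ Q) (φ : Finset ι → ℝ) :
    bern θ (insert i Q) φ = (1 - θ) * bern θ Q φ + θ * bern θ Q fun S => φ (insert i S) := by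
  unfold bern
  rw [Finset.sum_powerset_insert hi, Finset.mul_sum, Finset.mul_sum]
  congr 1
  · refine Finset.sum_congr rfl fun S hS => ?_
    have := Finset.card_le_card (Finset.mem_powerset.1 hS)
    rw [Finset.card_insert_of_notMem hi, Nat.sub_add_comm this, pow_succ]
    ring
  · refine Finset.sum_congr rfl fun S hS => ?_
    have : i ∉ S := fun h => hi (Finset.mem_powerset.1 hS h)
    rw [Finset.card_insert_of_notMem hi, Finset.card_insert_of_notMem this, Nat.add_sub_add_right,
      pow_succ]
    ring

lemma bern_const (θ c : ℝ) (Q : Finset ι) : bern θ Q (fun _ => c) = c := by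
  induction Q using Finset.induction_on with
  | empty => exact bern_empty _ _
  | insert i Q hi ih => rw [bern_insert θ hi, ih]; ring

lemma bern_one (Q : Finset ι) (φ : Finset ι → ℝ) : bern 1 Q φ = φ Q := by
  induction Q using Finset.induction_on generalizing φ with
  | empty => exact bern_empty _ _
  | insert i Q hi ih => rw [bern_insert 1 hi, ih, ih]; ring

lemma bern_ite (θ : ℝ) {Q : Finset ι} {i : ι} (hi : i ∈ Q) (φ : Finset ι → ℝ) :
    bern θ Q (fun S => if i ∈ S then φ S else 0) =
      θ * bern θ (Q.erase i) fun S => φ (insert i S) := by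
  conv_lhs => rw [← Finset.insert_erase hi]
  rw [bern_insert θ (Finset.notMem_erase i Q)]
  have : bern θ (Q.erase i) (fun S => if i ∈ S then φ S else 0) = 0 := by
    refine (bern_congr θ fun S hS => ?_).trans (bern_const θ 0 (Q.erase i))
    exact if_neg fun h => Finset.notMem_erase i Q (hS h)
  rw [this]
  simp

/-- A Russo formula: raising the density gains, per unit of `θ`, the average total discrete
derivative over the elements present, divided by `θ`. -/
lemma hasDerivAt_bern {θ : ℝ} (hθ : θ ≠ 0) (Q : Finset ι) (φ : Finset ι → ℝ) :
    HasDerivAt (fun t => bern t Q φ)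
      (θ⁻¹ * bern θ Q fun S => ∑ i ∈ S, (φ S - φ (S.erase i))) θ := by
  induction Q using Finset.induction_on generalizing φ with
  | empty => simpa [bern_empty] using hasDerivAt_const θ (φ ∅)
  | insert i Q hi ih =>
    simp only [bern_insert _ hi]
    have h := (((hasDerivAt_id θ).const_sub 1).mul (ih φ)).add
      ((hasDerivAt_id θ).mul (ih fun S => φ (insert i S)))
    refine h.congr_deriv ?_
    have e : bern θ Q (fun S => ∑ j ∈ insert i S, (φ (insert i S) - φ ((insert i S).erase j))) =
        bern θ Q (fun S => φ (insert i S)) - bern θ Q φ +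
          bern θ Q (fun S => ∑ j ∈ S, (φ (insert i S) - φ (insert i (S.erase j)))) := by
      rw [sub_eq_add_neg, ← neg_one_mul, ← bern_smul, ← bern_add, ← bern_add]
      refine bern_congr θ fun S hS => ?_
      have hiS : i ∉ S := fun h => hi (hS h)
      rw [Finset.sum_insert hiS, Finset.erase_insert hiS]
      congr 1
      · ring
      · refine Finset.sum_congr rfl fun j hj => ?_
        rw [Finset.erase_insert_of_ne fun h => hiS (by rw [h]; exact hj)]
    rw [e]
    simp only [id]
    field_simp
    ring

/-- If removing a uniformly random element of `S` loses at most a fraction `N / |S|` of `φ S`, then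
a random subset of density `θ` retains at least the fraction `θ ^ N`. -/
lemma pow_mul_le_bern {N : ℕ} {Q : Finset ι} {φ : Finset ι → ℝ}
    (h : ∀ S ⊆ Q, ∑ i ∈ S, (φ S - φ (S.erase i)) ≤ N * φ S) {θ : ℝ} (h0 : 0 < θ) (h1 : θ ≤ 1) :
    θ ^ N * φ Q ≤ bern θ Q φ := by
  have hd : ∀ t : ℝ, 0 < t → HasDerivAt (fun t => bern t Q φ / t ^ N)
      (((t⁻¹ * bern t Q fun S => ∑ i ∈ S, (φ S - φ (S.erase i))) * t ^ N -
        bern t Q φ * (N * t ^ (N - 1))) / (t ^ N) ^ 2) t := fun t ht =>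
    (hasDerivAt_bern ht.ne' Q φ).div (hasDerivAt_pow N t) (pow_pos ht N).ne'
  -- By the Russo formula and `h`, the logarithmic derivative of `bern` is at most that of `t ^ N`.
  -- The endpoint `t = 1` is the full set `Q`.
  have hanti : AntitoneOn (fun t => bern t Q φ / t ^ N) (Set.Icc θ 1) := by
    refine antitoneOn_of_deriv_nonpos (convex_Icc θ 1)
      (fun t ht => (hd t (h0.trans_le ht.1)).continuousAt.continuousWithinAt)
      (fun t ht => ?_) fun t ht => ?_ <;> rw [interior_Icc] at ht
    · exact (hd t (h0.trans ht.1)).differentiableAt.differentiableWithinAt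
    · have ht0 : 0 < t := h0.trans ht.1
      rw [(hd t ht0).deriv]
      refine div_nonpos_of_nonpos_of_nonneg ?_ (sq_nonneg _)
      have hb := bern_mono ht0.le ht.2.le h
      rw [bern_smul] at hb
      have e : (N : ℝ) * t ^ (N - 1) = N * (t⁻¹ * t ^ N) := by
        rcases N with _ | N
        · simp
        · rw [Nat.add_sub_cancel, pow_succ]; field_simp
      rw [e]
      have := mul_le_mul_of_nonneg_left hb (mul_nonneg (inv_pos.2 ht0).le (pow_nonneg ht0.le N))
      nlinarith
  have := hanti (Set.left_mem_Icc.2 h1) (Set.right_mem_Icc.2 h1) h1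
  simp only [bern_one, one_pow, div_one] at this
  rw [le_div_iff₀ (pow_pos h0 N)] at this
  linarith

end Bernoulli

/-! ### Approximate tensorization of entropy -/

/-- The sampling density at which random subsystems decouple. -/
noncomputable def density (α κ : ℝ) : ℝ := (1 - α) / (2 * (κ + 1))

/-- The constant of entropy tensorization. -/
noncomputable def entConst (α κ γ : ℝ) : ℝ :=
  (density α κ)⁻¹ ^ ⌈2 / (γ ^ 2 * (1 - α) ^ 2)⌉₊ * (4 / (γ * (1 - α) ^ 2))

lemma entConst_pos {α κ γ : ℝ} (hα : α < 1) (hκ : 0 ≤ κ) (hγ : 0 < γ) : 0 < entConst α κ γ := by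
  have : 0 < 1 - α := by linarith
  unfold entConst density
  positivity

/-- The local energy of `g` at the site `j`. -/
noncomputable def energy (p : Cube n → ℝ) (g : Cube n → ℝ) (j : Fin n) (x : Cube n) : ℝ :=
  cE p Finset.univ (fun y => (var1 p j y * |diff j g y|) ^ 2 / cE p {j} g y) x

namespace WeaklyDependent

variable {p : Cube n → ℝ} {M : Fin n → Fin n → ℝ} {α κ γ : ℝ} (H : WeaklyDependent p M α κ γ)
  {S : Finset (Fin n)} {g : Cube n → ℝ}
include H

lemma density_pos : 0 < density α κ :=
  div_pos (by linarith [H.alpha_lt]) (by linarith [H.kappa_nonneg])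

lemma density_le_one : density α κ ≤ 1 := by
  have := H.kappa_nonneg
  rw [density, div_le_one (by linarith)]
  linarith [H.alpha_nonneg]

/-- Induction through `resolv_col_le`: given `i ∈ S`, the rest of `S` is a random subset of `Q.erase
i`, so column `i` is bounded inductively. The event has probability `θ`, the density, and `κ * θ * 2
/ (1 - α) ≤ 1` by its choice, so the bracket is at most `1 + 1`. -/
lemma bern_resolv_col_le (m : ℕ) : ∀ (Q : Finset (Fin n)), Q.card = m → ∀ j ∉ Q,
    bern (density α κ) Q (fun S => ∑ k, resolv M (insert j S) k j) ≤ 2 / (1 - α) := by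
  have hθ := H.density_pos
  have hθ1 := H.density_le_one
  have hα : 0 < 1 - α := by linarith [H.alpha_lt]
  have hκ := H.kappa_nonneg
  induction m with
  | zero =>
    intro Q hQ j _
    rw [Finset.card_eq_zero.1 hQ, bern_empty]
    have := resolv_col_le H.nonneg H.row H.alpha_lt ∅ (Finset.notMem_empty j)
    refine this.trans ?_
    rw [Finset.sum_empty, add_zero, mul_one]
    gcongr
    norm_num
  | succ m ih =>
    intro Q hQ j hj
    have h1 : bern (density α κ) Q (fun S => ∑ k, resolv M (insert j S) k j) ≤
        bern (density α κ) Q (fun S => 1 / (1 - α) * (1 + ∑ i ∈ Q, M i j *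
          if i ∈ S then ∑ k, resolv M S k i else 0)) := by
      refine bern_mono hθ.le hθ1 fun S hS => ?_
      refine (resolv_col_le H.nonneg H.row H.alpha_lt S fun h => hj (hS h)).trans (le_of_eq ?_)
      simp only [mul_ite, mul_zero]
      rw [← Finset.sum_filter, Finset.filter_mem_eq_inter, Finset.inter_eq_right.2 hS]
    refine h1.trans ?_
    rw [bern_smul, bern_add, bern_const, bern_sum]
    have h2 : ∑ i ∈ Q, bern (density α κ) Q
        (fun S => M i j * if i ∈ S then ∑ k, resolv M S k i else 0) ≤
        ∑ i ∈ Q, M i j * (density α κ * (2 / (1 - α))) := by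
      refine Finset.sum_le_sum fun i hi => ?_
      rw [bern_smul, bern_ite _ hi]
      refine mul_le_mul_of_nonneg_left (mul_le_mul_of_nonneg_left ?_ hθ.le) (H.nonneg i j)
      exact ih (Q.erase i) (by rw [Finset.card_erase_of_mem hi, hQ, Nat.add_sub_cancel]) i
        (Finset.notMem_erase i Q)
    have h3 : ∑ i ∈ Q, M i j * (density α κ * (2 / (1 - α))) ≤ 1 := by
      rw [← Finset.sum_mul]
      have hc : ∑ i ∈ Q, M i j ≤ κ :=
        (Finset.sum_le_univ_sum_of_nonneg fun i => H.nonneg i j).trans (H.col j)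
      calc _ ≤ κ * (density α κ * (2 / (1 - α))) := by gcongr
        _ = κ / (κ + 1) := by unfold density; field_simp
        _ ≤ 1 := by rw [div_le_one (by linarith)]; linarith
    calc _ ≤ 1 / (1 - α) * (1 + 1) := by gcongr; exact h2.trans h3
      _ = _ := by ring

lemma cE_cEnt_sub_le {i : Fin n} {S' : Finset (Fin n)} (hi : i ∈ S) (hS : S ⊆ S')
    (hg : ∀ y, 0 < g y) (x : Cube n) :
    cE p Finset.univ (cEnt p S g) x - cE p Finset.univ (cEnt p (S.erase i) g) x ≤
      2 / (γ * (1 - α)) * ∑ j ∈ S, resolv M S' i j * energy p g j x := by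
  have hγ := H.gamma_pos
  have hα : 0 < 1 - α := by linarith [H.alpha_lt]
  rw [← cE_cE H.pos (Finset.subset_univ S) (cEnt p (S.erase i) g), ← cE_sub]
  have h : ∀ y, cEnt p S g y - cE p S (cEnt p (S.erase i) g) y ≤ 2 / γ * (1 / (1 - α)) *
      ∑ j ∈ S, resolv M S' i j *
        cE p S (fun y => (var1 p j y * |diff j g y|) ^ 2 / cE p {j} g y) y := fun y =>
    (H.cEnt_sub_le hi hg y).trans (by
      rw [mul_assoc]
      exact mul_le_mul_of_nonneg_left (H.cCov_up_sq_div_le hS hg i y) (by positivity))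
  refine (cE_mono H.pos fun y _ => h y).trans (le_of_eq ?_)
  rw [cE_smul, cE_sum]
  congr 1
  · field_simp
  · refine Finset.sum_congr rfl fun j _ => ?_
    rw [cE_smul, cE_cE H.pos (Finset.subset_univ S)]
    rfl

lemma energy_nonneg (hg : ∀ y, 0 < g y) (j : Fin n) (x : Cube n) : 0 ≤ energy p g j x :=
  cE_nonneg H.pos fun _ => div_nonneg (sq_nonneg _) (cE_pos H.pos hg).le

/-- Freeze the sites of `S` one at a time. Keeping `S'` fixed lets every step of the telescoping sum
use the same resolvent. -/
lemma cE_cEnt_le_sum (hg : ∀ y, 0 < g y) (x : Cube n) {S' : Finset (Fin n)} (hS : S ⊆ S') :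
    cE p Finset.univ (cEnt p S g) x ≤
      ∑ i ∈ S, 2 / (γ * (1 - α)) * ∑ j ∈ S', resolv M S' i j * energy p g j x := by
  have hγ := H.gamma_pos
  have hα : 0 < 1 - α := by linarith [H.alpha_lt]
  induction S using Finset.induction_on with
  | empty =>
    rw [Finset.sum_empty, ← cE_const H.pos (S := Finset.univ) (x := x) 0]
    exact cE_mono H.pos fun y _ => by simp [cEnt, cE_empty H.pos]
  | insert i S hi ih =>
    have h1 := H.cE_cEnt_sub_le (Finset.mem_insert_self i S) hS hg x
    rw [Finset.erase_insert hi] at h1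
    rw [Finset.sum_insert hi]
    have h2 : ∑ j ∈ insert i S, resolv M S' i j * energy p g j x ≤
        ∑ j ∈ S', resolv M S' i j * energy p g j x :=
      Finset.sum_le_sum_of_subset_of_nonneg hS fun j _ _ =>
        mul_nonneg (resolv_nonneg H.nonneg H.row H.alpha_lt S' i j) (H.energy_nonneg hg j x)
    have h3 := mul_le_mul_of_nonneg_left h2 (show 0 ≤ 2 / (γ * (1 - α)) by positivity)
    linarith [ih ((Finset.subset_insert i S).trans hS)]

/-- Approximate tensorization of the entropy. -/
theorem cEnt_univ_le (hg : ∀ y, 0 < g y) (x : Cube n) :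
    cEnt p Finset.univ g x ≤ entConst α κ γ * ∑ j, energy p g j x := by
  have hγ := H.gamma_pos
  have hα : 0 < 1 - α := by linarith [H.alpha_lt]
  have hθ := H.density_pos
  have hθ1 := H.density_le_one
  set N := ⌈2 / (γ ^ 2 * (1 - α) ^ 2)⌉₊ with hN
  set φ : Finset (Fin n) → ℝ := fun S => cE p Finset.univ (cEnt p S g) x with hφ
  have hE := fun j => H.energy_nonneg hg j x
  have h1 : ∀ S ⊆ (Finset.univ : Finset (Fin n)),
      ∑ i ∈ S, (φ S - φ (S.erase i)) ≤ N * φ S := by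
    intro S _
    have hpt : ∀ y, ∑ i ∈ S, (cEnt p S g y - cE p S (cEnt p (S.erase i) g) y) ≤
        N * cEnt p S g y := by
      intro y
      have hm := cE_pos H.pos (S := S) (x := y) hg
      have he := cEnt_nonneg H.pos (S := S) (x := y) hg
      calc _ ≤ ∑ i ∈ S, 2 / γ * (cCov p S g (up i) y ^ 2 / cE p S g y) :=
            Finset.sum_le_sum fun i hi => H.cEnt_sub_le hi hg y
        _ = 2 / γ * ((∑ i ∈ S, cCov p S g (up i) y ^ 2) / cE p S g y) := by
            rw [← Finset.mul_sum, Finset.sum_div]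
        _ ≤ 2 / γ * ((1 / (γ * (1 - α) ^ 2) * (cE p S g y * cEnt p S g y)) / cE p S g y) := by
            gcongr
            exact H.sum_cCov_up_sq_le hg y
        _ = 2 / (γ ^ 2 * (1 - α) ^ 2) * cEnt p S g y := by field_simp
        _ ≤ N * cEnt p S g y := by gcongr; exact Nat.le_ceil _
    have := cE_mono H.pos (S := Finset.univ) (x := x) fun y _ => hpt y
    rw [cE_smul, cE_sum] at this
    refine le_trans (le_of_eq (Finset.sum_congr rfl fun i _ => ?_)) this
    rw [cE_sub, cE_cE H.pos (Finset.subset_univ S)]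
  have h2 := pow_mul_le_bern h1 hθ hθ1
  have h3 : φ Finset.univ = cEnt p Finset.univ g x := by
    rw [hφ, ← cE_const H.pos (S := Finset.univ) (x := x) (cEnt p Finset.univ g x)]
    refine cE_congr fun y hy => ?_
    unfold cEnt
    rw [cE_agree _ hy, cE_agree _ hy]
  -- After exchanging sums, the energy at `j` is weighted by a column sum of the resolvent of the
  -- random set, and only if that set contains `j`.
  have h4 : bern (density α κ) Finset.univ φ ≤ bern (density α κ) Finset.univ (fun S =>
      ∑ j, 2 / (γ * (1 - α)) * energy p g j x * if j ∈ S then ∑ i, resolv M S i j else 0) := by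
    refine bern_mono hθ.le hθ1 fun S _ => ?_
    refine (H.cE_cEnt_le_sum hg x subset_rfl).trans ?_
    rw [← Finset.mul_sum, Finset.sum_comm, Finset.mul_sum]
    simp only [mul_ite, mul_zero]
    rw [← Finset.sum_filter, Finset.filter_mem_eq_inter, Finset.univ_inter]
    refine Finset.sum_le_sum fun j _ => ?_
    rw [← Finset.sum_mul, mul_assoc, mul_comm (energy p g j x)]
    refine mul_le_mul_of_nonneg_left (mul_le_mul_of_nonneg_right ?_ (hE j)) (by positivity)
    exact Finset.sum_le_univ_sum_of_nonneg fun i =>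
      resolv_nonneg H.nonneg H.row H.alpha_lt S i j
  have h5 : bern (density α κ) Finset.univ φ ≤
      4 / (γ * (1 - α) ^ 2) * ∑ j, energy p g j x := by
    refine h4.trans ?_
    rw [bern_sum, Finset.mul_sum]
    refine Finset.sum_le_sum fun j _ => ?_
    rw [bern_smul, bern_ite _ (Finset.mem_univ j)]
    have hb := H.bern_resolv_col_le _ (Finset.univ.erase j) rfl j (Finset.notMem_erase _ _)
    have := hE j
    calc _ ≤ 2 / (γ * (1 - α)) * energy p g j x * (1 * (2 / (1 - α))) := by
          refine mul_le_mul_of_nonneg_left ?_ (by positivity)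
          refine (mul_le_mul_of_nonneg_left hb hθ.le).trans ?_
          exact mul_le_mul_of_nonneg_right hθ1 (by positivity)
      _ = _ := by field_simp; ring
  rw [← h3]
  have h6 := h2.trans h5
  unfold entConst
  rw [← hN, mul_assoc, inv_pow, ← div_eq_inv_mul, le_div_iff₀ (pow_pos hθ N), mul_comm]
  exact h6

end WeaklyDependent

/-! ### The modified logarithmic Sobolev inequality -/

/-- The squared norm of the vector of all differences of `f`. -/
def gradSq (f : Cube n → ℝ) (x : Cube n) : ℝ := ∑ j, diff j f x ^ 2

lemma gradSq_nonneg (f : Cube n → ℝ) (x : Cube n) : 0 ≤ gradSq f x :=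
  Finset.sum_nonneg fun _ _ => sq_nonneg _

lemma gradSq_smul (c : ℝ) (f : Cube n → ℝ) (x : Cube n) :
    gradSq (fun y => c * f y) x = c ^ 2 * gradSq f x := by
  unfold gradSq diff
  rw [Finset.mul_sum]
  exact Finset.sum_congr rfl fun j _ => by ring

/-- The modified logarithmic Sobolev inequality with constant `C` for the weights `p`. -/
def LogSobolev (p : Cube n → ℝ) (C : ℝ) : Prop :=
  ∀ f x, cEnt p Finset.univ (fun y => Real.exp (f y)) x ≤
    C * cE p Finset.univ (fun y => gradSq f y * Real.exp (f y)) x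

lemma abs_exp_sub_exp_le (s t : ℝ) :
    |Real.exp s - Real.exp t| ≤ |s - t| * max (Real.exp s) (Real.exp t) := by
  wlog h : t ≤ s generalizing s t
  · rw [abs_sub_comm, abs_sub_comm s, max_comm]
    exact this t s (le_of_not_ge h)
  have he := Real.exp_le_exp.2 h
  rw [abs_of_nonneg (sub_nonneg.2 he), abs_of_nonneg (sub_nonneg.2 h), max_eq_left he]
  have h1 := Real.add_one_le_exp (t - s)
  have h2 : Real.exp t = Real.exp s * Real.exp (t - s) := by rw [← Real.exp_add]; ring_nf
  rw [h2]
  nlinarith [Real.exp_pos s]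

namespace WeaklyDependent

variable {p : Cube n → ℝ} {M : Fin n → Fin n → ℝ} {α κ γ : ℝ} (H : WeaklyDependent p M α κ γ)
include H

/-- Both values of `e^f` on a pair of neighbours are at most `1 / γ` times the local mean, so the
normalized squared difference is at most `|diff j f| ^ 2` times that mean over `γ ^ 2`. -/
lemma energy_exp_le (f : Cube n → ℝ) (j : Fin n) (x : Cube n) :
    energy p (fun y => Real.exp (f y)) j x ≤
      1 / γ ^ 2 * cE p Finset.univ (fun y => diff j f y ^ 2 * Real.exp (f y)) x := by
  have hγ := H.gamma_pos
  have hpt : ∀ y, (var1 p j y * |diff j (fun y => Real.exp (f y)) y|) ^ 2 /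
      cE p {j} (fun y => Real.exp (f y)) y ≤
      1 / γ ^ 2 * cE p {j} (fun z => diff j f z ^ 2 * Real.exp (f z)) y := by
    intro y
    have hm := cE_pos H.pos (S := {j}) (x := y) (g := fun y => Real.exp (f y))
      fun _ => Real.exp_pos _
    rw [cE_mul_of_const (h := fun z => diff j f z ^ 2) (g := fun y => Real.exp (f y)), div_le_iff₀ hm]
    · have h1 := abs_exp_sub_exp_le (f (Function.update y j 1)) (f (Function.update y j (-1)))
      have h2 : γ * max (Real.exp (f (Function.update y j 1)))
          (Real.exp (f (Function.update y j (-1)))) ≤ cE p {j} (fun y => Real.exp (f y)) y := by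
        rw [cE_singleton H.pos]
        have ha := H.le_cond j y
        have hb := H.cond_le j y
        have e1 := Real.exp_pos (f (Function.update y j 1))
        have e2 := Real.exp_pos (f (Function.update y j (-1)))
        rcases max_choice (Real.exp (f (Function.update y j 1)))
          (Real.exp (f (Function.update y j (-1)))) with h | h <;> rw [h] <;> nlinarith
      set m := cE p {j} (fun y => Real.exp (f y)) y
      have hv0 := var1_nonneg H.pos j y
      have hv1 := var1_le (p := p) j y
      have h3 : var1 p j y * |diff j (fun y => Real.exp (f y)) y| ≤ |diff j f y| * (m / γ) := by
        calc _ ≤ 1 * |diff j (fun y => Real.exp (f y)) y| := by gcongr; linarith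
          _ ≤ |diff j f y| * max (Real.exp (f (Function.update y j 1)))
              (Real.exp (f (Function.update y j (-1)))) := by rw [one_mul]; exact h1
          _ ≤ _ := by
              gcongr
              rw [le_div_iff₀ hγ]
              linarith
      calc _ ≤ (|diff j f y| * (m / γ)) ^ 2 := by gcongr
        _ = _ := by rw [mul_pow, sq_abs]; field_simp
    · intro z hz
      have : ∀ s, Function.update z j s = Function.update y j s := by
        intro s
        funext k
        by_cases e : k = j
        · subst e; simp
        · rw [Function.update_of_ne e, Function.update_of_ne e]
          exact mem_fiber.1 hz k (by simpa using e)
      simp only [diff, this]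
  unfold energy
  refine (cE_mono H.pos fun y _ => hpt y).trans (le_of_eq ?_)
  rw [cE_smul, cE_cE H.pos (Finset.subset_univ _)]

theorem logSobolev : LogSobolev p (entConst α κ γ * (1 / γ ^ 2)) := by
  intro f x
  refine (H.cEnt_univ_le (fun _ => Real.exp_pos _) x).trans ?_
  rw [mul_assoc]
  refine mul_le_mul_of_nonneg_left ?_
    (entConst_pos H.alpha_lt H.kappa_nonneg H.gamma_pos).le
  refine (Finset.sum_le_sum fun j _ => H.energy_exp_le f j x).trans (le_of_eq ?_)
  rw [← Finset.mul_sum, ← cE_sum]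
  simp only [gradSq, Finset.sum_mul]

end WeaklyDependent

/-! ### Exponential moments and the Poincaré inequality -/

section
variable {p : Cube n → ℝ} (hp : ∀ x, 0 < p x) {S : Finset (Fin n)} {x : Cube n}
include hp

/-- Gibbs variational principle without normalizing `g`: compare `g` pointwise with the multiple of
`e^h` that has the same mean. -/
lemma cE_mul_le_cEnt {g : Cube n → ℝ} (hg : ∀ y, 0 < g y) (h : Cube n → ℝ) :
    cE p S (fun y => h y * g y) x ≤
      cEnt p S g x + cE p S g x * Real.log (cE p S (fun y => Real.exp (h y)) x) := by
  have hm := cE_pos hp (S := S) (x := x) hg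
  have hZ := cE_pos hp (S := S) (x := x) (g := fun y => Real.exp (h y)) fun _ => Real.exp_pos _
  unfold cEnt
  set m := cE p S g x with hm_def
  set Z := cE p S (fun y => Real.exp (h y)) x with hZ_def
  have key := cE_mono hp (S := S) (x := x) (h := fun y => g y * Real.log (g y))
    (g := fun y => h y * g y + ((Real.log m - Real.log Z) * g y +
      (g y - m / Z * Real.exp (h y)))) fun y _ => by
    have hv : 0 < m / Z * Real.exp (h y) := mul_pos (div_pos hm hZ) (Real.exp_pos _)
    have := Real.one_sub_inv_le_log_of_pos (div_pos (hg y) hv)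
    rw [Real.log_div (hg y).ne' hv.ne', inv_div, Real.log_mul (div_pos hm hZ).ne'
      (Real.exp_pos _).ne', Real.log_exp, Real.log_div hm.ne' hZ.ne'] at this
    have := mul_le_mul_of_nonneg_left this (hg y).le
    have e : g y * (1 - m / Z * Real.exp (h y) / g y) = g y - m / Z * Real.exp (h y) := by
      have := (hg y).ne'
      field_simp
    linarith
  rw [cE_add, cE_add, cE_smul, cE_sub, cE_smul, ← hm_def, ← hZ_def, div_mul_cancel₀ _ hZ.ne'] at key
  linarith

lemma log_cE_exp_smul_le {t : ℝ} (h0 : 0 ≤ t) (h1 : t ≤ 1) (Y : Cube n → ℝ) :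
    Real.log (cE p S (fun y => Real.exp (t * Y y)) x) ≤
      t * Real.log (cE p S (fun y => Real.exp (Y y)) x) := by
  have hZ := cE_pos hp (S := S) (x := x) (g := fun y => Real.exp (Y y)) fun _ => Real.exp_pos _
  set Z := cE p S (fun y => Real.exp (Y y)) x with hZ_def
  rw [Real.log_le_iff_le_exp (cE_pos hp fun _ => Real.exp_pos _)]
  have key : ∀ y, Real.exp (t * Y y) ≤ Real.exp (t * Real.log Z) *
      ((1 - t) + t / Z * Real.exp (Y y)) := by
    intro y
    have hc := convexOn_exp.2 (Set.mem_univ 0) (Set.mem_univ (Y y - Real.log Z))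
      (sub_nonneg.2 h1) h0 (by ring)
    simp only [smul_eq_mul, mul_zero, zero_add, Real.exp_zero, mul_one] at hc
    rw [Real.exp_sub, Real.exp_log hZ] at hc
    have e : Real.exp (t * Y y) = Real.exp (t * Real.log Z) *
        Real.exp (t * (Y y - Real.log Z)) := by rw [← Real.exp_add]; ring_nf
    rw [e]
    refine mul_le_mul_of_nonneg_left (hc.trans (le_of_eq ?_)) (Real.exp_pos _).le
    ring
  have := cE_mono hp (S := S) (x := x) fun y _ => key y
  rw [cE_smul, cE_add, cE_const hp, cE_smul, ← hZ_def, div_mul_cancel₀ _ hZ.ne'] at this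
  linarith

lemma log_cE_exp_mono {u v : Cube n → ℝ} (h : ∀ y, u y ≤ v y) :
    Real.log (cE p S (fun y => Real.exp (u y)) x) ≤ Real.log (cE p S (fun y => Real.exp (v y)) x) :=
  Real.log_le_log (cE_pos hp fun _ => Real.exp_pos _)
    (cE_mono hp fun y _ => Real.exp_le_exp.2 (h y))

lemma log_cE_exp_const_add (c : ℝ) (u : Cube n → ℝ) :
    Real.log (cE p S (fun y => Real.exp (c + u y)) x) =
      c + Real.log (cE p S (fun y => Real.exp (u y)) x) := by
  simp only [Real.exp_add]
  rw [cE_smul, Real.log_mul (Real.exp_pos _).ne' (cE_pos hp fun _ => Real.exp_pos _).ne',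
    Real.log_exp]

omit hp in
lemma hasDerivAt_cE_exp (f : Cube n → ℝ) (s : ℝ) :
    HasDerivAt (fun s => cE p S (fun y => Real.exp (s * f y)) x)
      (cE p S (fun y => f y * Real.exp (s * f y)) x) s := by
  unfold cE
  refine HasDerivAt.div_const ?_ _
  refine HasDerivAt.fun_sum fun y _ => ?_
  refine (((hasDerivAt_id s).mul_const (f y)).exp.const_mul (p y)).congr_deriv ?_
  simp only [id]
  ring

variable {C : ℝ} (hC : 0 < C) (hLS : LogSobolev p C)
include hC hLS

omit hC in
-- Testing the variational principle against `2 * C * gradSq f` bounds twice the log-Sobolev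
-- right-hand side by entropy plus the logarithmic term; one copy of the entropy cancels.
lemma cEnt_exp_le (f : Cube n → ℝ) :
    cEnt p Finset.univ (fun y => Real.exp (f y)) x ≤
      cE p Finset.univ (fun y => Real.exp (f y)) x *
        Real.log (cE p Finset.univ (fun y => Real.exp (2 * C * gradSq f y)) x) := by
  have h1 := hLS f x
  have h2 := cE_mul_le_cEnt hp (S := Finset.univ) (x := x) (g := fun y => Real.exp (f y))
    (fun _ => Real.exp_pos _) (fun y => 2 * C * gradSq f y)
  have h3 : cE p Finset.univ (fun y => 2 * C * gradSq f y * Real.exp (f y)) x =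
      2 * (C * cE p Finset.univ (fun y => gradSq f y * Real.exp (f y)) x) := by
    rw [← mul_assoc, ← cE_smul]
    exact cE_congr fun y _ => by ring
  rw [h3] at h2
  linarith

omit hC in
/-- Exponential moments of `f` are controlled by those of its squared gradient. -/
theorem log_cE_exp_le (f : Cube n → ℝ) :
    Real.log (cE p Finset.univ (fun y => Real.exp (f y)) x) ≤ cE p Finset.univ f x +
      Real.log (cE p Finset.univ (fun y => Real.exp (2 * C * gradSq f y)) x) := by
  set b := Real.log (cE p Finset.univ (fun y => Real.exp (2 * C * gradSq f y)) x) with hb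
  set Z : ℝ → ℝ := fun s => cE p Finset.univ (fun y => Real.exp (s * f y)) x with hZ
  set Z' : ℝ → ℝ := fun s => cE p Finset.univ (fun y => f y * Real.exp (s * f y)) x with hZ'
  have hZpos : ∀ s, 0 < Z s := fun s => cE_pos hp fun _ => Real.exp_pos _
  have hZd : ∀ s, HasDerivAt Z (Z' s) s := fun s => hasDerivAt_cE_exp f s
  set ψ : ℝ → ℝ := fun s => Real.log (Z s) with hψ
  have hψd : ∀ s, HasDerivAt ψ (Z' s / Z s) s := fun s => (hZd s).log (hZpos s).ne'
  have hent : ∀ s, 0 ≤ s → s ≤ 1 → s * Z' s - Z s * ψ s ≤ Z s * (s ^ 2 * b) := by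
    intro s h0 h1
    have h := cEnt_exp_le hp hLS (fun y => s * f y) (x := x)
    have e : cEnt p Finset.univ (fun y => Real.exp (s * f y)) x = s * Z' s - Z s * ψ s := by
      unfold cEnt
      simp only [hZ', hψ, hZ]
      rw [← cE_smul]
      congr 1
      exact cE_congr fun y _ => by rw [Real.log_exp]; ring
    rw [e] at h
    refine h.trans (mul_le_mul_of_nonneg_left ?_ (hZpos s).le)
    -- The squared gradient of `s * f` carries a factor `s ^ 2 ≤ 1`, which Jensen's inequality pulls
    -- out of the logarithmic moment.
    have h2 := log_cE_exp_smul_le hp (S := Finset.univ) (x := x) (sq_nonneg s)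
      (pow_le_one₀ h0 h1) (fun y => 2 * C * gradSq f y)
    refine le_trans (le_of_eq ?_) h2
    congr 1
    exact cE_congr fun y _ => by rw [gradSq_smul]; ring_nf
  have hKd : ∀ s, 0 < s → HasDerivAt (fun s => ψ s / s - b * s)
      ((Z' s / Z s * s - ψ s * 1) / s ^ 2 - b * 1) s := fun s hs =>
    ((hψd s).div (hasDerivAt_id s) hs.ne').sub ((hasDerivAt_id s).const_mul b)
  -- Herbst's argument: the entropy bound says that `ψ s / s - b * s` does not increase. Its limit
  -- at zero is the mean of `f`.
  have hanti : AntitoneOn (fun s => ψ s / s - b * s) (Set.Ioc 0 1) := by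
    refine antitoneOn_of_deriv_nonpos (convex_Ioc 0 1)
      (fun s hs => (hKd s hs.1).continuousAt.continuousWithinAt)
      (fun s hs => ?_) fun s hs => ?_ <;> rw [interior_Ioc] at hs
    · exact (hKd s hs.1).differentiableAt.differentiableWithinAt
    · rw [(hKd s hs.1).deriv, sub_nonpos, mul_one, mul_one, div_le_iff₀ (pow_pos hs.1 2)]
      have h := hent s hs.1.le hs.2.le
      have e : Z' s / Z s * s - ψ s = (s * Z' s - Z s * ψ s) / Z s := by
        have := (hZpos s).ne'
        field_simp
      rw [e, div_le_iff₀ (hZpos s)]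
      linarith
  have hψ0 : ψ 0 = 0 := by
    simp only [hψ, hZ, zero_mul, Real.exp_zero]
    rw [cE_const hp, Real.log_one]
  have hd0 : HasDerivAt ψ (cE p Finset.univ f x) 0 := by
    refine (hψd 0).congr_deriv ?_
    simp only [hZ, hZ', zero_mul, Real.exp_zero, mul_one]
    rw [cE_const hp, div_one]
  have hlim : Filter.Tendsto (fun s => ψ s / s - b * s) (nhdsWithin 0 (Set.Ioi 0))
      (nhds (cE p Finset.univ f x - b * 0)) := by
    refine Filter.Tendsto.sub ?_ ((continuous_const.mul continuous_id).continuousWithinAt)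
    have := hd0.tendsto_slope_zero_right
    refine this.congr' (Filter.Eventually.of_forall fun s => ?_)
    simp [hψ0, div_eq_inv_mul]
  have hle : ψ 1 / 1 - b * 1 ≤ cE p Finset.univ f x - b * 0 := by
    refine ge_of_tendsto hlim ?_
    filter_upwards [Ioc_mem_nhdsGT (zero_lt_one' ℝ)] with s hs
    exact hanti hs (Set.right_mem_Ioc.2 one_pos) hs.2
  have h1 : ψ 1 = Real.log (cE p Finset.univ (fun y => Real.exp (f y)) x) := by
    simp only [hψ, hZ, one_mul]
  rw [← h1]
  linarith

/-- The Poincaré inequality. -/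
theorem variance_le (f : Cube n → ℝ) :
    cE p Finset.univ (fun y => (f y - cE p Finset.univ f x) ^ 2) x ≤
      16 * C * cE p Finset.univ (gradSq f) x := by
  set m := cE p Finset.univ f x with hm
  set G := ∑ z, gradSq f z + 1 with hG
  have hG1 : 0 < G := by
    have : 0 ≤ ∑ z, gradSq f z := Finset.sum_nonneg fun z _ => gradSq_nonneg f z
    linarith
  have hΓ : ∀ y, gradSq f y ≤ G := fun y => by
    have := Finset.single_le_sum (f := gradSq f) (fun z _ => gradSq_nonneg f z) (Finset.mem_univ y)
    linarith
  -- With this `s` the exponent `2 * C * s ^ 2 * gradSq f` lies in `[0, 1]`, where `exp v ≤ 1 + 2 *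
  -- v`.
  set s := √(1 / (2 * C * G)) with hs
  have hs2 : s ^ 2 = 1 / (2 * C * G) := Real.sq_sqrt (by positivity)
  have hs0 : 0 < s ^ 2 := by rw [hs2]; positivity
  have hup : cE p Finset.univ (fun y => Real.exp (2 * C * (s ^ 2 * gradSq f y))) x ≤
      1 + 4 * C * s ^ 2 * cE p Finset.univ (gradSq f) x := by
    rw [← cE_smul, ← cE_const hp (S := Finset.univ) (x := x) 1, ← cE_add]
    refine cE_mono hp fun y _ => ?_
    have h0 : 0 ≤ 2 * C * (s ^ 2 * gradSq f y) :=
      mul_nonneg (by positivity) (mul_nonneg hs0.le (gradSq_nonneg f y))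
    have h1 : 2 * C * (s ^ 2 * gradSq f y) ≤ 1 := by
      calc _ ≤ 2 * C * (s ^ 2 * G) := by gcongr; exact hΓ y
        _ = 1 := by rw [hs2]; field_simp
    have h2 := Real.abs_exp_sub_one_sub_id_le (x := 2 * C * (s ^ 2 * gradSq f y))
      (by rw [abs_of_nonneg h0]; exact h1)
    have h3 := (abs_le.1 h2).2
    nlinarith
  have hone : ∀ e : ℝ, e ^ 2 = 1 →
      cE p Finset.univ (fun y => Real.exp (e * s * (f y - m))) x ≤
        1 + 4 * C * s ^ 2 * cE p Finset.univ (gradSq f) x := by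
    intro e he
    refine le_trans ?_ hup
    have h := log_cE_exp_le hp hLS (fun y => e * s * f y) (x := x)
    have h1 : cE p Finset.univ (fun y => Real.exp (2 * C * gradSq (fun y => e * s * f y) y)) x =
        cE p Finset.univ (fun y => Real.exp (2 * C * (s ^ 2 * gradSq f y))) x :=
      cE_congr fun y _ => by rw [gradSq_smul, mul_pow, he, one_mul]
    rw [h1, cE_smul, ← hm] at h
    have h2 := log_cE_exp_const_add hp (S := Finset.univ) (x := x) (-(e * s * m))
      (fun y => e * s * f y)
    have h3 : cE p Finset.univ (fun y => Real.exp (-(e * s * m) + e * s * f y)) x =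
        cE p Finset.univ (fun y => Real.exp (e * s * (f y - m))) x :=
      cE_congr fun y _ => by ring_nf
    rw [h3] at h2
    rw [← Real.log_le_log_iff (cE_pos hp fun _ => Real.exp_pos _)
      (cE_pos hp fun _ => Real.exp_pos _)]
    linarith
  have hlow : 2 + s ^ 2 / 2 * cE p Finset.univ (fun y => (f y - m) ^ 2) x ≤
      cE p Finset.univ (fun y => Real.exp (1 * s * (f y - m))) x +
        cE p Finset.univ (fun y => Real.exp (-1 * s * (f y - m))) x := by
    rw [← cE_smul, ← cE_add, ← cE_const hp (S := Finset.univ) (x := x) 2, ← cE_add]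
    refine cE_mono hp fun y _ => ?_
    rw [cE_const hp]
    have key : ∀ u : ℝ, 2 + u ^ 2 / 2 ≤ Real.exp u + Real.exp (-u) := by
      intro u
      have h1 := Real.quadratic_le_exp_of_nonneg (abs_nonneg u)
      have h2 := Real.add_one_le_exp (-|u|)
      rw [sq_abs] at h1
      rcases abs_choice u with h | h <;> rw [h] at h1 h2
      · linarith
      · rw [neg_neg] at h2; linarith
    have := key (s * (f y - m))
    calc _ = 2 + (s * (f y - m)) ^ 2 / 2 := by ring
      _ ≤ _ := this
      _ = _ := by ring_nf
  have h1 := hone 1 (by norm_num)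
  have h2 := hone (-1) (by norm_num)
  have h3 : s ^ 2 * cE p Finset.univ (fun y => (f y - m) ^ 2) x ≤
      s ^ 2 * (16 * C * cE p Finset.univ (gradSq f) x) := by linarith
  exact le_of_mul_le_mul_left h3 hs0

/-- Exponential moments of a function whose squared gradient is at most affine in the function. -/
lemma log_cE_exp_le_of_gradSq_le {W : Cube n → ℝ} {A B μ : ℝ} (hW : ∀ y, 0 ≤ W y)
    (hΓ : ∀ y, gradSq W y ≤ A * W y + B) (hμ : 0 ≤ μ) (hμA : 4 * C * μ * A ≤ 1) :
    Real.log (cE p Finset.univ (fun y => Real.exp (μ * W y)) x) ≤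
      2 * μ * cE p Finset.univ W x + 4 * C * μ ^ 2 * B := by
  have h := log_cE_exp_le hp hLS (fun y => μ * W y) (x := x)
  have h1 : Real.log (cE p Finset.univ
      (fun y => Real.exp (2 * C * gradSq (fun y => μ * W y) y)) x) ≤
      Real.log (cE p Finset.univ (fun y => Real.exp (2 * C * μ ^ 2 * B + 1 / 2 * (μ * W y))) x) := by
    refine log_cE_exp_mono hp fun y => ?_
    rw [gradSq_smul]
    have h1 := mul_le_mul_of_nonneg_left (hΓ y) (show 0 ≤ 2 * C * μ ^ 2 by positivity)
    have h2 := mul_le_mul_of_nonneg_right hμA (mul_nonneg hμ (hW y))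
    linarith
  rw [log_cE_exp_const_add hp] at h1
  -- The moment at `μ / 2` is at most half the logarithmic moment at `μ`, so it is absorbed on the
  -- left.
  have h2 := log_cE_exp_smul_le hp (S := Finset.univ) (x := x) (show (0 : ℝ) ≤ 1 / 2 by norm_num)
    (by norm_num) (fun y => μ * W y)
  rw [cE_smul] at h
  linarith

end

/-! ### Second order: gradients controlled by the pseudo Hessian -/

variable {n₁ n₂ : ℕ}

lemma diff_eq (f : Cube n → ℝ) (j : Fin n) (x : Cube n) : diff j f x = 2 * discreteDeriv f j x := by
  unfold diff discreteDeriv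
  ring

lemma gradSq_eq (f : Cube n → ℝ) (x : Cube n) : gradSq f x = 4 * ‖discreteGrad f x‖ ^ 2 := by
  rw [EuclideanSpace.norm_sq_eq, Finset.mul_sum]
  refine Finset.sum_congr rfl fun j _ => ?_
  rw [diff_eq, Real.norm_eq_abs, sq_abs]
  simp only [discreteGrad]
  ring

lemma norm_vecMul_le (A : Matrix (Fin n₁) (Fin n₂) ℝ) (u : Fin n₁ → ℝ) :
    ‖WithLp.toLp 2 (Matrix.vecMul u A)‖ ≤ specNorm A * ‖WithLp.toLp 2 u‖ := by
  set v := Matrix.vecMul u A with hv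
  have h1 : ‖WithLp.toLp 2 v‖ ^ 2 =
      inner ℝ (WithLp.toLp 2 u : EuclideanSpace ℝ (Fin n₁))
        (Matrix.toEuclideanLin A (WithLp.toLp 2 v)) := by
    rw [EuclideanSpace.norm_sq_eq, Matrix.toLpLin_toLp, EuclideanSpace.inner_toLp_toLp]
    simp only [star_trivial, Real.norm_eq_abs, sq_abs]
    rw [dotProduct_comm, Matrix.toLin'_apply, Matrix.dotProduct_mulVec, ← hv]
    exact Finset.sum_congr rfl fun j _ => sq _
  have h2 : ‖Matrix.toEuclideanLin A (WithLp.toLp 2 v)‖ ≤ specNorm A * ‖WithLp.toLp 2 v‖ :=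
    (LinearMap.toContinuousLinearMap (Matrix.toEuclideanLin A)).le_opNorm _
  have h3 := real_inner_le_norm (WithLp.toLp 2 u : EuclideanSpace ℝ (Fin n₁))
    (Matrix.toEuclideanLin A (WithLp.toLp 2 v))
  have h4 : ‖WithLp.toLp 2 v‖ * ‖WithLp.toLp 2 v‖ ≤
      (specNorm A * ‖WithLp.toLp 2 u‖) * ‖WithLp.toLp 2 v‖ := by
    rw [← sq, h1]
    refine h3.trans ((mul_le_mul_of_nonneg_left h2 (norm_nonneg _)).trans (le_of_eq ?_))
    ring
  rcases (norm_nonneg (WithLp.toLp 2 v)).eq_or_lt with h | h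
  · rw [← h]
    exact mul_nonneg (norm_nonneg _) (norm_nonneg _)
  · exact le_of_mul_le_mul_right h4 h

section
variable {D : Cube n → EuclideanSpace ℝ (Fin n₁)} {H : Cube n → Matrix (Fin n₁) (Fin n₂) ℝ}
  (hH : IsPseudoHessian D H)
include hH

lemma gradSq_linear_le {h : ℝ} (x : Cube n) (hh : specNorm (H x) ≤ h) (u : Fin n₁ → ℝ) :
    gradSq (fun y => ∑ k, u k * D y k) x ≤ 4 * (h ^ 2 * ∑ k, u k ^ 2) := by
  have h0 : 0 ≤ h := (norm_nonneg _).trans hh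
  have h1 : ‖discreteGrad (fun y => ∑ k, u k * D y k) x‖ ≤ h * ‖WithLp.toLp 2 u‖ :=
    ((hH u x).trans (norm_vecMul_le _ _)).trans
      (mul_le_mul_of_nonneg_right hh (norm_nonneg _))
  have h2 : ‖WithLp.toLp 2 u‖ ^ 2 = ∑ k, u k ^ 2 := by
    rw [EuclideanSpace.norm_sq_eq]
    simp only [Real.norm_eq_abs, sq_abs]
  rw [gradSq_eq, ← h2, ← mul_pow]
  gcongr

lemma sum_gradSq_le {F2 : ℝ} (x : Cube n) (hF : frobNorm (H x) ^ 2 ≤ F2) :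
    ∑ k, gradSq (fun y => D y k) x ≤ 4 * F2 := by
  have hF2 : frobNorm (H x) ^ 2 = ∑ i, ∑ j, H x i j ^ 2 :=
    Real.sq_sqrt (Finset.sum_nonneg fun i _ => Finset.sum_nonneg fun j _ => sq_nonneg _)
  rw [hF2] at hF
  refine le_trans ?_ (mul_le_mul_of_nonneg_left hF (by norm_num))
  rw [Finset.mul_sum]
  refine Finset.sum_le_sum fun k _ => ?_
  have h1 := hH (Pi.single k 1) x
  have e : (fun y => ∑ l, (Pi.single k 1 : Fin n₁ → ℝ) l * D y l) = fun y => D y k := by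
    funext y
    simp [Pi.single_apply]
  rw [e, Matrix.single_one_vecMul] at h1
  rw [gradSq_eq]
  refine mul_le_mul_of_nonneg_left ?_ (by norm_num)
  have h2 : ‖WithLp.toLp 2 (H x k)‖ ^ 2 = ∑ j, H x k j ^ 2 := by
    rw [EuclideanSpace.norm_sq_eq]
    simp only [Real.norm_eq_abs, sq_abs]
  rw [← h2]
  exact pow_le_pow_left₀ (norm_nonneg _) h1 2

/-- The difference of a squared distance is a linear term plus or minus the square of the increment.
The linear term is bounded by the spectral norm. The increments have squared norms `s j ≤ 4 * h ^ 2`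
with `∑ s j ≤ 4 * F2`, hence `∑ s j ^ 2 ≤ 16 * h ^ 2 * F2`. -/
lemma gradSq_sq_dist_le {h F2 : ℝ} (m : Fin n₁ → ℝ) (x : Cube n) (hh : specNorm (H x) ≤ h)
    (hF : frobNorm (H x) ^ 2 ≤ F2) :
    gradSq (fun y => ∑ k, (D y k - m k) ^ 2) x ≤
      32 * h ^ 2 * ∑ k, (D x k - m k) ^ 2 + 32 * h ^ 2 * F2 := by
  set d : Fin n → Fin n₁ → ℝ := fun j k => diff j (fun y => D y k) x with hd
  set s : Fin n → ℝ := fun j => ∑ k, d j k ^ 2 with hs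
  have hlin : ∀ (u : Fin n₁ → ℝ) (j : Fin n), diff j (fun y => ∑ k, u k * D y k) x =
      ∑ k, u k * d j k := fun u j => diff_sum _ u j fun k y => D y k
  have hs0 : ∀ j, 0 ≤ s j := fun j => Finset.sum_nonneg fun k _ => sq_nonneg _
  have hs1 : ∀ j, s j ≤ 4 * h ^ 2 := by
    intro j
    -- Test the Hessian on the increment `d j` itself: entry `j` of that gradient is `s j`.
    have h1 := gradSq_linear_le hH x hh (d j)
    have h2 : diff j (fun y => ∑ k, d j k * D y k) x ^ 2 ≤
        gradSq (fun y => ∑ k, d j k * D y k) x :=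
      Finset.single_le_sum (f := fun l => diff l (fun y => ∑ k, d j k * D y k) x ^ 2)
        (fun l _ => sq_nonneg _) (Finset.mem_univ j)
    have h3 : diff j (fun y => ∑ k, d j k * D y k) x = s j := by
      rw [hlin]
      exact Finset.sum_congr rfl fun k _ => (sq _).symm
    rw [h3] at h2
    have h4 : s j * s j ≤ (4 * h ^ 2) * s j := by
      have := h2.trans h1
      simp only [hs] at this ⊢
      linarith
    rcases (hs0 j).eq_or_lt with e | e
    · rw [← e]; positivity
    · exact le_of_mul_le_mul_right h4 e
  have hs2 : ∑ j, s j ≤ 4 * F2 := by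
    rw [Finset.sum_comm]
    exact sum_gradSq_le hH x hF
  have hW : ∀ j, diff j (fun y => ∑ k, (D y k - m k) ^ 2) x ^ 2 ≤
      8 * (∑ k, (D x k - m k) * d j k) ^ 2 + 2 * s j ^ 2 := by
    intro j
    -- The sign depends on whether `x` is the upper or the lower end of the edge in direction `j`.
    have key : ∃ e : ℝ, e ^ 2 = 1 ∧ diff j (fun y => ∑ k, (D y k - m k) ^ 2) x =
        2 * (∑ k, (D x k - m k) * d j k) + e * s j := by
      rcases Int.units_eq_one_or (x j) with hx | hx
      · refine ⟨-1, by norm_num, ?_⟩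
        have hx' : D x = D (Function.update x j 1) := by rw [← hx, Function.update_eq_self]
        simp only [hs, hd, diff]
        rw [hx', Finset.mul_sum, Finset.mul_sum, ← Finset.sum_add_distrib,
          ← Finset.sum_sub_distrib]
        exact Finset.sum_congr rfl fun k _ => by ring
      · refine ⟨1, by norm_num, ?_⟩
        have hx' : D x = D (Function.update x j (-1)) := by rw [← hx, Function.update_eq_self]
        simp only [hs, hd, diff]
        rw [hx', Finset.mul_sum, Finset.mul_sum, ← Finset.sum_add_distrib,
          ← Finset.sum_sub_distrib]
        exact Finset.sum_congr rfl fun k _ => by ring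
    obtain ⟨e, he, hde⟩ := key
    rw [hde]
    set a := ∑ k, (D x k - m k) * d j k
    have : (2 * a + e * s j) ^ 2 + (2 * a - e * s j) ^ 2 = 8 * a ^ 2 + 2 * (e ^ 2 * s j ^ 2) := by
      ring
    rw [he, one_mul] at this
    linarith [sq_nonneg (2 * a - e * s j)]
  have h1 : ∑ j, (∑ k, (D x k - m k) * d j k) ^ 2 ≤ 4 * (h ^ 2 * ∑ k, (D x k - m k) ^ 2) := by
    have := gradSq_linear_le hH x hh fun k => D x k - m k
    unfold gradSq at this
    simpa only [hlin] using this
  have h2 : ∑ j, s j ^ 2 ≤ 4 * h ^ 2 * (4 * F2) := by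
    calc ∑ j, s j ^ 2 ≤ ∑ j, 4 * h ^ 2 * s j :=
          Finset.sum_le_sum fun j _ => by
            rw [sq]; exact mul_le_mul_of_nonneg_right (hs1 j) (hs0 j)
      _ = 4 * h ^ 2 * ∑ j, s j := by rw [Finset.mul_sum]
      _ ≤ _ := by gcongr
  calc gradSq (fun y => ∑ k, (D y k - m k) ^ 2) x
      ≤ ∑ j, (8 * (∑ k, (D x k - m k) * d j k) ^ 2 + 2 * s j ^ 2) :=
        Finset.sum_le_sum fun j _ => hW j
    _ = 8 * ∑ j, (∑ k, (D x k - m k) * d j k) ^ 2 + 2 * ∑ j, s j ^ 2 := by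
        rw [Finset.sum_add_distrib, Finset.mul_sum, Finset.mul_sum]
    _ ≤ _ := by linarith

variable {p : Cube n → ℝ} (hp : ∀ x, 0 < p x) {C : ℝ} (hC : 0 < C) (hLS : LogSobolev p C)
  {x : Cube n}
include hp hC hLS

/-- The second order bound for exponential moments. -/
theorem log_cE_exp_le_of_pseudo {f : Cube n → ℝ} (hD : IsPseudoDeriv f D) {h F2 : ℝ}
    (hh : ∀ y, specNorm (H y) ≤ h) (hF : ∀ y, frobNorm (H y) ^ 2 ≤ F2) {l : ℝ}
    (hl : 2048 * C ^ 2 * (l ^ 2 * h ^ 2) ≤ 1) :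
    Real.log (cE p Finset.univ (fun y => Real.exp (l * f y)) x) ≤ l * cE p Finset.univ f x +
      (16 * C + 2048 * C ^ 2) * (l ^ 2 *
        (∑ k, cE p Finset.univ (fun y => D y k) x ^ 2 + F2)) := by
  set m : Fin n₁ → ℝ := fun k => cE p Finset.univ (fun y => D y k) x with hm
  set W : Cube n → ℝ := fun y => ∑ k, (D y k - m k) ^ 2 with hW
  have hF0 : 0 ≤ F2 := (sq_nonneg _).trans (hF x)
  have hm0 : 0 ≤ ∑ k, m k ^ 2 := Finset.sum_nonneg fun _ _ => sq_nonneg _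
  have hW0 : ∀ y, 0 ≤ W y := fun y => Finset.sum_nonneg fun _ _ => sq_nonneg _
  have hgf : ∀ y, gradSq f y ≤ 8 * ∑ k, m k ^ 2 + 8 * W y := by
    intro y
    rw [gradSq_eq]
    have h1 : ‖discreteGrad f y‖ ^ 2 ≤ ‖D y‖ ^ 2 := pow_le_pow_left₀ (norm_nonneg _) (hD y) 2
    rw [EuclideanSpace.norm_sq_eq (D y)] at h1
    have h2 : ∑ k, ‖D y k‖ ^ 2 ≤ 2 * ∑ k, m k ^ 2 + 2 * W y := by
      rw [hW, Finset.mul_sum, Finset.mul_sum, ← Finset.sum_add_distrib]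
      refine Finset.sum_le_sum fun k _ => ?_
      rw [Real.norm_eq_abs, sq_abs]
      nlinarith [sq_nonneg (D y k - 2 * m k)]
    linarith
  have hEW : cE p Finset.univ W x ≤ 64 * C * F2 := by
    rw [hW, cE_sum]
    refine (Finset.sum_le_sum fun k _ => variance_le hp hC hLS (fun y => D y k)).trans ?_
    rw [← Finset.mul_sum, ← cE_sum]
    have : cE p Finset.univ (fun y => ∑ k, gradSq (fun z => D z k) y) x ≤ 4 * F2 := by
      rw [← cE_const hp (S := Finset.univ) (x := x) (4 * F2)]
      exact cE_mono hp fun y _ => sum_gradSq_le hH y (hF y)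
    calc _ ≤ 16 * C * (4 * F2) := mul_le_mul_of_nonneg_left this (by positivity)
      _ = _ := by ring
  have h1 := log_cE_exp_le hp hLS (fun y => l * f y) (x := x)
  have h2 : Real.log (cE p Finset.univ
      (fun y => Real.exp (2 * C * gradSq (fun y => l * f y) y)) x) ≤
      Real.log (cE p Finset.univ (fun y => Real.exp (16 * C * l ^ 2 * ∑ k, m k ^ 2 +
        16 * C * l ^ 2 * W y)) x) := by
    refine log_cE_exp_mono hp fun y => ?_
    rw [gradSq_smul]
    have := mul_le_mul_of_nonneg_left (hgf y) (show 0 ≤ 2 * C * l ^ 2 by positivity)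
    linarith
  rw [log_cE_exp_const_add hp] at h2
  -- For these values `4 * C * μ * A = 2048 * C ^ 2 * l ^ 2 * h ^ 2`, which is the smallness
  -- condition `hl`.
  have h3 := log_cE_exp_le_of_gradSq_le hp hC hLS (W := W) (A := 32 * h ^ 2)
    (B := 32 * h ^ 2 * F2) (μ := 16 * C * l ^ 2) (x := x) hW0
    (fun y => gradSq_sq_dist_le hH m y (hh y) (hF y)) (by positivity) (by linarith)
  rw [cE_smul] at h1
  have h4 := mul_le_mul_of_nonneg_left hEW (show 0 ≤ 2 * (16 * C * l ^ 2) by positivity)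
  have h5 := mul_le_mul_of_nonneg_right hl (show 0 ≤ 16 * C * l ^ 2 * F2 by positivity)
  have h6 : 0 ≤ 2048 * C ^ 2 * (l ^ 2 * ∑ k, m k ^ 2) := by positivity
  linarith

end


/-! ### From Dobrushin's condition to weak dependence -/

section Law

variable {π : Measure (Cube n)} [IsProbabilityMeasure π]

omit [IsProbabilityMeasure π] in
lemma coe_fiber_singleton (i : Fin n) (x : Cube n) :
    {y : Cube n | ∀ k, k ≠ i → y k = x k} = (fiber {i} x : Set (Cube n)) := by
  ext y
  simp

lemma condProb_eq (i : Fin n) (x : Cube n) (s : ℤˣ) :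
    condProb π i x s =
      π.real {Function.update x i s} / ∑ y ∈ fiber {i} x, π.real {y} := by
  have h1 : {y : Cube n | ∀ k, k ≠ i → y k = x k} ∩ {y | y i = s} = {Function.update x i s} := by
    ext y
    simp only [Set.mem_inter_iff, Set.mem_ofPred_eq, Set.mem_singleton_iff]
    constructor
    · rintro ⟨h, hs⟩
      funext k
      by_cases e : k = i
      · subst e; simpa using hs
      · rw [Function.update_of_ne e, h k e]
    · rintro rfl
      exact ⟨fun k hk => Function.update_of_ne hk _ _, Function.update_self _ _ _⟩
  unfold condProb
  rw [measureReal_def, cond_apply (MeasurableSet.of_discrete) π, h1, ENNReal.toReal_mul,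
    ENNReal.toReal_inv, coe_fiber_singleton, ← measureReal_def, ← measureReal_def,
    sum_measureReal_singleton, div_eq_inv_mul]

/-- A null configuration would have conditional probability zero at any of its coordinates. For `n =
0` there is no coordinate, but the single point is the whole space. -/
lemma real_singleton_pos {γ : ℝ} (hγ : 0 < γ) (h : ∀ i x s, γ ≤ condProb π i x s) (x : Cube n) :
    0 < π.real {x} := by
  rcases n with _ | n
  · have : ({x} : Set (Cube 0)) = Set.univ := Set.eq_univ_of_forall fun y => Subsingleton.elim _ _
    rw [this, probReal_univ]
    exact one_pos
  · have h1 := h 0 x (x 0)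
    rw [condProb_eq, Function.update_eq_self] at h1
    by_contra! h2
    have h3 : π.real {x} = 0 := le_antisymm h2 measureReal_nonneg
    rw [h3, zero_div] at h1
    linarith

lemma condProb_one_eq (i : Fin n) (x : Cube n) :
    condProb π i x 1 = cE (fun y => π.real {y}) {i} (up i) x := by
  rw [condProb_eq]
  unfold cE
  congr 1
  rw [Finset.sum_eq_single (Function.update x i 1)]
  · simp
  · intro y hy hne
    have : y i ≠ 1 := by
      intro e
      refine hne (funext fun k => ?_)
      by_cases h : k = i
      · subst h; simpa using e
      · rw [Function.update_of_ne h]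
        exact mem_fiber.1 hy k (by simpa using h)
    simp [up, this]
  · intro h
    exact absurd (update_mem_fiber (Finset.mem_singleton_self i) 1 (self_mem_fiber {i} x)) h

lemma condProb_neg_one_eq (hp : ∀ x, 0 < π.real {x}) (i : Fin n) (x : Cube n) :
    condProb π i x (-1) = 1 - cE (fun y => π.real {y}) {i} (up i) x := by
  have h := cE_singleton (p := fun y => π.real {y}) hp i
    (fun y => if y i = -1 then 1 else 0) (x := x)
  simp only [Function.update_self, if_true, mul_one] at h
  rw [if_neg (by simp), mul_zero, zero_add] at h
  rw [← h, condProb_eq]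
  unfold cE
  congr 1
  rw [Finset.sum_eq_single (Function.update x i (-1))]
  · simp
  · intro y hy hne
    have : y i ≠ -1 := by
      intro e
      refine hne (funext fun k => ?_)
      by_cases h : k = i
      · subst h; simpa using e
      · rw [Function.update_of_ne h]
        exact mem_fiber.1 hy k (by simpa using h)
    simp [this]
  · intro h
    exact absurd (update_mem_fiber (Finset.mem_singleton_self i) (-1) (self_mem_fiber {i} x)) h

lemma condTV_eq (hp : ∀ x, 0 < π.real {x}) (i : Fin n) (x y : Cube n) :
    condTV π i x y = |cE (fun y => π.real {y}) {i} (up i) x -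
      cE (fun y => π.real {y}) {i} (up i) y| := by
  unfold condTV
  have hu : (Finset.univ : Finset ℤˣ) = {1, -1} := by decide
  rw [hu, Finset.sum_pair (by decide), condProb_one_eq, condProb_one_eq, condProb_neg_one_eq hp,
    condProb_neg_one_eq hp, sub_sub_sub_cancel_left, abs_sub_comm (cE _ _ _ y)]
  ring

omit [IsProbabilityMeasure π] in
lemma influence_nonneg (j i : Fin n) : 0 ≤ influence π j i :=
  Real.iSup_nonneg fun _ => div_nonneg (Finset.sum_nonneg fun _ _ => abs_nonneg _) zero_le_two

lemma abs_diff_le_influence (hp : ∀ x, 0 < π.real {x}) (l j : Fin n) (x : Cube n) :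
    |diff j (cE (fun y => π.real {y}) {l} (up l)) x| ≤ influence π j l := by
  unfold diff
  rw [← condTV_eq hp]
  refine le_ciSup (f := fun q : {q : Cube n × Cube n // q.1 j ≠ q.2 j ∧ ∀ k, k ≠ j →
    q.1 k = q.2 k} => condTV π l q.1.1 q.1.2) (Set.finite_range _).bddAbove
    ⟨(Function.update x j 1, Function.update x j (-1)), ?_, fun k hk => ?_⟩
  · simp
  · simp [Function.update_of_ne hk]

omit [IsProbabilityMeasure π] in
lemma sum_influence_le (l : Fin n) : ∑ j, influence π j l ≤ dobrushinCoeff π :=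
  le_ciSup (f := fun l => ∑ j, influence π j l) (Set.finite_range _).bddAbove l

lemma cE_up_eq_div {p : Cube n → ℝ} (i : Fin n) (x : Cube n) :
    cE p {i} (up i) x = p (Function.update x i 1) /
      (p (Function.update x i 1) + p (Function.update x i (-1))) := by
  have h : fiber {i} x = {Function.update x i 1, Function.update x i (-1)} := by
    ext y
    simp only [mem_fiber, Finset.mem_singleton, Finset.mem_insert]
    constructor
    · intro h
      have key : ∀ s, y i = s → y = Function.update x i s := by
        intro s hs
        funext k
        by_cases e : k = i
        · subst e; simpa using hs
        · rw [Function.update_of_ne e, h k e]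
      rcases Int.units_eq_one_or (y i) with e | e
      exacts [Or.inl (key _ e), Or.inr (key _ e)]
    · rintro (rfl | rfl) k hk <;> rw [Function.update_of_ne hk]
  have hne : Function.update x i 1 ≠ Function.update x i (-1) := by
    intro e
    have := congrFun e i
    simp at this
  unfold cE
  rw [h, Finset.sum_pair hne, Finset.sum_pair hne]
  simp

/-- For a positive two by two table, both differences of conditional probabilities have the
numerator `A * D - B * C`; only the denominators differ, and these are comparable up to `γ ^ 2`. -/
lemma abs_div_sub_div_le {A B C D γ : ℝ} (hA : 0 < A) (hB : 0 < B) (hC : 0 < C) (hD : 0 < D)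
    (hγ : 0 < γ) (h1 : γ ≤ A / (A + C)) (h2 : γ ≤ B / (B + D)) (h3 : γ ≤ 1 - A / (A + C))
    (h4 : γ ≤ 1 - B / (B + D)) :
    |A / (A + B) - C / (C + D)| ≤ 1 / γ ^ 2 * |A / (A + C) - B / (B + D)| := by
  have e1 : A / (A + B) - C / (C + D) = (A * D - B * C) / ((A + B) * (C + D)) := by
    field_simp; ring
  have e2 : A / (A + C) - B / (B + D) = (A * D - B * C) / ((A + C) * (B + D)) := by
    field_simp; ring
  have e3 : 1 - A / (A + C) = C / (A + C) := by field_simp; ring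
  have e4 : 1 - B / (B + D) = D / (B + D) := by field_simp; ring
  rw [e3] at h3
  rw [e4] at h4
  rw [le_div_iff₀ (by positivity)] at h1 h2 h3 h4
  rw [e1, e2, abs_div, abs_div, abs_of_pos (show 0 < (A + B) * (C + D) by positivity),
    abs_of_pos (show 0 < (A + C) * (B + D) by positivity), div_mul_div_comm, one_mul]
  refine div_le_div_of_nonneg_left (abs_nonneg _) (by positivity) ?_
  calc γ ^ 2 * ((A + C) * (B + D))
      ≤ (γ * (A + C) + γ * (B + D)) * (γ * (A + C) + γ * (B + D)) := by
        have : 0 ≤ γ * (A + C) := by positivity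
        have : 0 ≤ γ * (B + D) := by positivity
        nlinarith
    _ ≤ (A + B) * (C + D) := by gcongr

omit [IsProbabilityMeasure π] in
lemma abs_diff_le_mul_abs_diff {γ : ℝ} (hγ : 0 < γ) (hp : ∀ x, 0 < π.real {x})
    (hlo : ∀ k x, γ ≤ cE (fun y => π.real {y}) {k} (up k) x)
    (hhi : ∀ k x, cE (fun y => π.real {y}) {k} (up k) x ≤ 1 - γ) {l j : Fin n} (hlj : j ≠ l)
    (x : Cube n) : |diff j (cE (fun y => π.real {y}) {l} (up l)) x| ≤
      1 / γ ^ 2 * |diff l (cE (fun y => π.real {y}) {j} (up j)) x| := by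
  have a1 := hlo j (Function.update x l 1)
  have a2 := hlo j (Function.update x l (-1))
  have a3 := hhi j (Function.update x l 1)
  have a4 := hhi j (Function.update x l (-1))
  unfold diff
  simp only [cE_up_eq_div] at *
  simp only [Function.update_comm hlj] at *
  exact abs_div_sub_div_le (hp _) (hp _) (hp _) (hp _) hγ a1 a2 (by linarith) (by linarith)

/-- Near-symmetry of influences. It turns the row bound of Dobrushin's condition into the column
bound `κ`. -/
lemma influence_le_mul_influence {γ : ℝ} (hγ : 0 < γ) (hγ1 : γ ≤ 1) (hp : ∀ x, 0 < π.real {x})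
    (hlo : ∀ k x, γ ≤ cE (fun y => π.real {y}) {k} (up k) x)
    (hhi : ∀ k x, cE (fun y => π.real {y}) {k} (up k) x ≤ 1 - γ) (l j : Fin n) :
    influence π j l ≤ 1 / γ ^ 2 * influence π l j := by
  have hK : 1 ≤ 1 / γ ^ 2 := by
    rw [le_div_iff₀ (by positivity), one_mul]
    exact pow_le_one₀ hγ.le hγ1
  by_cases hlj : j = l
  · subst hlj
    exact le_mul_of_one_le_left (influence_nonneg j j) hK
  refine Real.iSup_le (fun q => ?_) (mul_nonneg (by positivity) (influence_nonneg l j))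
  obtain ⟨⟨x, y⟩, hne, hxy⟩ := q
  simp only at hne hxy ⊢
  have hb := (abs_diff_le_mul_abs_diff hγ hp hlo hhi hlj x).trans
    (mul_le_mul_of_nonneg_left (abs_diff_le_influence hp j l x) (by positivity))
  refine le_trans (le_of_eq ?_) hb
  rw [condTV_eq hp]
  have hy : y = Function.update x j (y j) := by
    funext k
    by_cases e : k = j
    · subst e; simp
    · rw [Function.update_of_ne e, hxy k e]
  have hx : x = Function.update x j (x j) := (Function.update_eq_self j x).symm
  unfold diff
  rcases Int.units_eq_one_or (x j) with e1 | e1 <;> rcases Int.units_eq_one_or (y j) with e2 | e2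
  · exact absurd (e1.trans e2.symm) hne
  · rw [e1] at hx; rw [e2] at hy; rw [← hx, ← hy]
  · rw [e1] at hx; rw [e2] at hy; rw [← hx, ← hy, abs_sub_comm]
  · exact absurd (e1.trans e2.symm) hne

/-- Dobrushin bounded laws are weakly dependent, with the influences as interaction matrix. -/
theorem weaklyDependent_of_isDobrushinBounded {α γ : ℝ} (hα : α < 1) (hγ : 0 < γ)
    (h : IsDobrushinBounded α γ π) :
    WeaklyDependent (fun y => π.real {y}) (fun l j => influence π j l) (max α 0)
      (1 / min γ (1 / 2) ^ 2 * max α 0) (min γ (1 / 2)) := by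
  have hp := real_singleton_pos hγ h.le_condProb
  have hlo : ∀ k x, min γ (1 / 2) ≤ cE (fun y => π.real {y}) {k} (up k) x := fun k x => by
    rw [← condProb_one_eq]
    exact (min_le_left _ _).trans (h.le_condProb k x 1)
  have hhi : ∀ k x, cE (fun y => π.real {y}) {k} (up k) x ≤ 1 - min γ (1 / 2) := fun k x => by
    have h1 := h.le_condProb k x (-1)
    rw [condProb_neg_one_eq hp] at h1
    linarith [min_le_left γ (1 / 2)]
  have hγ' : 0 < min γ (1 / 2) := lt_min hγ (by norm_num)
  have hrow : ∀ l, ∑ j, influence π j l ≤ max α 0 := fun l =>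
    (sum_influence_le l).trans (h.coeff_le.trans (le_max_left _ _))
  exact
    { pos := hp
      nonneg := fun l j => influence_nonneg j l
      infl := fun l j _ x => abs_diff_le_influence hp l j x
      row := hrow
      col := fun j => by
        refine (Finset.sum_le_sum fun l _ => influence_le_mul_influence hγ'
          ((min_le_right _ _).trans (by norm_num)) hp hlo hhi l j).trans ?_
        rw [← Finset.mul_sum]
        exact mul_le_mul_of_nonneg_left (hrow j) (by positivity)
      alpha_nonneg := le_max_right _ _
      alpha_lt := max_lt hα one_pos
      kappa_nonneg := mul_nonneg (by positivity) (le_max_right _ _)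
      gamma_pos := hγ'
      gamma_le := min_le_right _ _
      le_cond := hlo
      cond_le := hhi }

lemma sum_real_singleton : ∑ y, π.real {y} = 1 := by
  rw [sum_measureReal_singleton, Finset.coe_univ, probReal_univ]

lemma cE_univ_eq_sum (g : Cube n → ℝ) (x : Cube n) :
    cE (fun y => π.real {y}) Finset.univ g x = ∑ y, π.real {y} * g y := by
  have : fiber Finset.univ x = (Finset.univ : Finset (Cube n)) := by ext; simp
  unfold cE
  rw [this, sum_real_singleton, div_one]

lemma cE_univ_eq_integral (g : Cube n → ℝ) (x : Cube n) :
    cE (fun y => π.real {y}) Finset.univ g x = ∫ y, g y ∂π := by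
  rw [cE_univ_eq_sum, integral_fintype .of_finite]
  simp

end Law

/-! ### The tail bound -/

/-- The constant in the exponent. -/
noncomputable def tailConst (C : ℝ) : ℝ := 1 / (2 * (16 * C + 2048 * C ^ 2) + 64 * C)

/-- The tail bound at every real level below the tail exponent. -/
theorem real_tail_le {π : Measure (Cube n)} [IsProbabilityMeasure π] {C : ℝ} (hC : 0 < C)
    (hp : ∀ x, 0 < π.real {x}) (hLS : LogSobolev (fun y => π.real {y}) C) {f : Cube n → ℝ}
    {D : Cube n → EuclideanSpace ℝ (Fin n₁)} {H : Cube n → Matrix (Fin n₁) (Fin n₂) ℝ}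
    (hD : IsPseudoDeriv f D) (hH : IsPseudoHessian D H) {h F2 t r : ℝ}
    (hh : ∀ y, specNorm (H y) ≤ h) (hF : ∀ y, frobNorm (H y) ^ 2 ≤ F2) (ht : 0 < t) (hr : 0 ≤ r)
    (hr1 : r * (∑ k, (∫ y, D y k ∂π) ^ 2 + F2) ≤ t ^ 2) (hr2 : r * h ≤ t) :
    π.real {y | t < |f y - ∫ z, f z ∂π|} ≤ 2 * Real.exp (-(tailConst C / 2 * r)) := by
  set c := tailConst C with hc
  set K := 16 * C + 2048 * C ^ 2 with hK
  have hK0 : 0 < K := by positivity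
  have hc0 : 0 < c := by rw [hc, tailConst]; positivity
  have hcK : c * K ≤ 1 / 2 := by
    rw [hc, tailConst, ← hK, div_mul_eq_mul_div, one_mul, div_le_div_iff₀ (by positivity) (by norm_num)]
    linarith
  have hcC : 64 * C * c ≤ 1 := by
    rw [hc, tailConst, mul_one_div, div_le_one (by positivity)]
    linarith
  set x : Cube n := fun _ => 1
  have hh0 : 0 ≤ h := (norm_nonneg _).trans (hh x)
  set V := ∑ k, (∫ y, D y k ∂π) ^ 2 + F2 with hV
  -- Chernoff parameter: `l * t = c * r`, the second order term is at most `c * r / 2` because `c *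
  -- K ≤ 1 / 2`, and `l * h ≤ c` with `64 * C * c ≤ 1` gives the smallness condition.
  set l := c * r / t with hl
  have hl0 : 0 ≤ l := by positivity
  have hlt : l * t = c * r := by rw [hl]; field_simp
  have hlV : l ^ 2 * V ≤ c ^ 2 * r := by
    have : l ^ 2 * V = c ^ 2 * r * ((r * V) / t ^ 2) := by rw [hl]; field_simp
    rw [this]
    refine mul_le_of_le_one_right (by positivity) ?_
    rw [div_le_one (by positivity)]
    exact hr1
  have hlh : 2048 * C ^ 2 * (l ^ 2 * h ^ 2) ≤ 1 := by
    have h1 : l * h ≤ c := by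
      have : l * h = c * ((r * h) / t) := by rw [hl]; field_simp
      rw [this]
      refine mul_le_of_le_one_right hc0.le ?_
      rw [div_le_one ht]
      exact hr2
    have h2 : 64 * C * (l * h) ≤ 1 :=
      (mul_le_mul_of_nonneg_left h1 (by positivity)).trans hcC
    have h3 : (64 * C * (l * h)) ^ 2 ≤ 1 :=
      pow_le_one₀ (by positivity) h2
    nlinarith [sq_nonneg (C * (l * h))]
  set m := ∫ z, f z ∂π with hm
  have hexp : ∀ e : ℝ, e ^ 2 = 1 →
      cE (fun y => π.real {y}) Finset.univ (fun y => Real.exp (e * l * (f y - m) - l * t)) x ≤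
        Real.exp (-(c / 2 * r)) := by
    intro e he
    have h1 := log_cE_exp_le_of_pseudo hH hp hC hLS hD hh hF (l := e * l) (x := x)
      (by rw [mul_pow, he, one_mul]; exact hlh)
    rw [cE_univ_eq_integral f, ← hm, mul_pow, he, one_mul, ← hK] at h1
    simp only [cE_univ_eq_integral (fun y => D y _)] at h1
    rw [← hV] at h1
    have h2 := log_cE_exp_const_add hp (S := Finset.univ) (x := x) (-(e * l * m) - l * t)
      (fun y => e * l * f y)
    have h3 : cE (fun y => π.real {y}) Finset.univ
        (fun y => Real.exp (-(e * l * m) - l * t + e * l * f y)) x =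
        cE (fun y => π.real {y}) Finset.univ
          (fun y => Real.exp (e * l * (f y - m) - l * t)) x :=
      cE_congr fun y _ => by ring_nf
    rw [h3] at h2
    rw [← Real.log_le_iff_le_exp (cE_pos hp fun _ => Real.exp_pos _), h2]
    have h4 := mul_le_mul_of_nonneg_left hlV hK0.le
    have h5 := mul_le_mul_of_nonneg_right hcK (mul_nonneg hc0.le hr)
    nlinarith
  have h1 := hexp 1 (by norm_num)
  have h2 := hexp (-1) (by norm_num)
  have h3 : π.real {y | t < |f y - m|} = ∑ y, π.real {y} * if t < |f y - m| then 1 else 0 := by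
    simp only [mul_ite, mul_one, mul_zero]
    rw [← Finset.sum_filter, sum_measureReal_singleton]
    simp
  rw [h3]
  have h4 : ∑ y, π.real {y} * (if t < |f y - m| then 1 else 0) ≤
      cE (fun y => π.real {y}) Finset.univ (fun y => Real.exp (1 * l * (f y - m) - l * t) +
        Real.exp (-1 * l * (f y - m) - l * t)) x := by
    rw [← cE_univ_eq_sum _ x]
    refine cE_mono hp fun y _ => ?_
    split_ifs with hy
    · have e1 := Real.exp_pos (1 * l * (f y - m) - l * t)
      have e2 := Real.exp_pos (-1 * l * (f y - m) - l * t)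
      have hy' := mul_le_mul_of_nonneg_left hy.le hl0
      rcases abs_choice (f y - m) with ha | ha <;> rw [ha] at hy'
      · have := Real.one_le_exp (x := 1 * l * (f y - m) - l * t) (by linarith)
        linarith
      · have := Real.one_le_exp (x := -1 * l * (f y - m) - l * t) (by linarith)
        linarith
    · positivity
  rw [cE_add] at h4
  linarith

lemma norm_integral_sq {Ω : Type*} [MeasurableSpace Ω] {P : Measure Ω} [IsProbabilityMeasure P]
    {X : Ω → Cube n} (hX : Measurable X) (D : Cube n → EuclideanSpace ℝ (Fin n₁)) :
    ‖∫ ω, D (X ω) ∂P‖ ^ 2 = ∑ k, (∫ y, D y k ∂(P.map X)) ^ 2 := by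
  have := Measure.isProbabilityMeasure_map (μ := P) hX.aemeasurable
  have h1 : ∫ ω, D (X ω) ∂P = ∫ y, D y ∂(P.map X) :=
    (integral_map hX.aemeasurable (Measurable.of_discrete (f := D)).aestronglyMeasurable).symm
  rw [h1, EuclideanSpace.norm_sq_eq]
  refine Finset.sum_congr rfl fun k _ => ?_
  rw [Real.norm_eq_abs, sq_abs]
  congr 1
  exact ((EuclideanSpace.proj k : EuclideanSpace ℝ (Fin n₁) →L[ℝ] ℝ).integral_comp_comm
    (Integrable.of_finite (f := D))).symm

/-- From bounds at all real levels to a bound at an extended real exponent. -/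
lemma le_two_mul_exp_neg {q : ℝ≥0∞} (hq : q ≠ ∞) {c : ℝ} (hc : 0 < c) {E : ℝ≥0∞}
    (h : ∀ r : ℝ, 0 ≤ r → ENNReal.ofReal r ≤ E → q.toReal ≤ 2 * Real.exp (-(c * r))) :
    q ≤ 2 * EReal.exp (-((ENNReal.ofReal c * E : ℝ≥0∞) : EReal)) := by
  rcases eq_or_ne E ∞ with rfl | hE
  -- An infinite exponent makes the bound available at every level `r`; let `r` tend to infinity.
  · have h0 : q.toReal ≤ 0 := by
      have hlim : Filter.Tendsto (fun r : ℝ => 2 * Real.exp (-(c * r))) Filter.atTop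
          (nhds (2 * 0)) :=
        (Real.tendsto_exp_neg_atTop_nhds_zero.comp
          (Filter.tendsto_id.const_mul_atTop hc)).const_mul 2
      rw [mul_zero] at hlim
      refine ge_of_tendsto hlim ?_
      filter_upwards [Filter.eventually_ge_atTop (0 : ℝ)] with r hr
      exact h r hr le_top
    have : q = 0 := by
      have := le_antisymm h0 ENNReal.toReal_nonneg
      exact ((ENNReal.toReal_eq_zero_iff q).1 this).resolve_right hq
    rw [this]
    exact zero_le
  · have h1 := h E.toReal ENNReal.toReal_nonneg (ENNReal.ofReal_toReal hE).le
    have e : ENNReal.ofReal c * E = ENNReal.ofReal (c * E.toReal) := by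
      rw [ENNReal.ofReal_mul hc.le, ENNReal.ofReal_toReal hE]
    rw [e, EReal.coe_ennreal_ofReal, max_eq_left (mul_nonneg hc.le ENNReal.toReal_nonneg),
      ← EReal.coe_neg, EReal.exp_coe, ← ENNReal.ofReal_toReal hq]
    refine (ENNReal.ofReal_le_ofReal h1).trans (le_of_eq ?_)
    rw [ENNReal.ofReal_mul zero_le_two, ENNReal.ofReal_ofNat]

end CubeConc

theorem theorem2 (α γ : ℝ) (hα : α < 1) (hγ : 0 < γ) :
    ∃ c : ℝ, 0 < c ∧
      ∀ (n n₁ n₂ : ℕ) (Ω : Type*) [MeasurableSpace Ω] (P : Measure Ω) [IsProbabilityMeasure P]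
        (X : Ω → Cube n), Measurable X → IsDobrushinBounded α γ (P.map X) →
        ∀ (f : Cube n → ℝ) (D : Cube n → EuclideanSpace ℝ (Fin n₁))
          (H : Cube n → Matrix (Fin n₁) (Fin n₂) ℝ),
          IsPseudoDeriv f D → IsPseudoHessian D H →
          ∀ t : ℝ, 0 < t →
            P {ω | t < |f (X ω) - ∫ ω', f (X ω') ∂P|} ≤
              2 * EReal.exp (-((ENNReal.ofReal c * tailExponent P X D H t : ℝ≥0∞) : EReal)) := by
  -- `WeaklyDependent` requires `0 ≤ α` and `γ ≤ 1 / 2`, which are not assumed here; replacing them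
  -- by `max α 0` and `min γ (1 / 2)` only weakens the bounds.
  have hα' : max α 0 < 1 := max_lt hα one_pos
  have hγ' : 0 < min γ (1 / 2) := lt_min hγ (by norm_num)
  have hκ : 0 ≤ 1 / min γ (1 / 2) ^ 2 * max α 0 := mul_nonneg (by positivity) (le_max_right _ _)
  set C := CubeConc.entConst (max α 0) (1 / min γ (1 / 2) ^ 2 * max α 0) (min γ (1 / 2)) *
    (1 / min γ (1 / 2) ^ 2) with hC_def
  have hC : 0 < C := mul_pos (CubeConc.entConst_pos hα' hκ hγ') (by positivity)
  have hc : 0 < CubeConc.tailConst C / 2 := by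
    unfold CubeConc.tailConst
    positivity
  refine ⟨_, hc, ?_⟩
  intro n n₁ n₂ Ω _ P _ X hX hbd f D H hD hH t ht
  have := Measure.isProbabilityMeasure_map (μ := P) hX.aemeasurable
  have hW := CubeConc.weaklyDependent_of_isDobrushinBounded hα hγ hbd
  have hmean : ∫ ω', f (X ω') ∂P = ∫ y, f y ∂(P.map X) :=
    (integral_map hX.aemeasurable (Measurable.of_discrete (f := f)).aestronglyMeasurable).symm
  have hset : P {ω | t < |f (X ω) - ∫ ω', f (X ω') ∂P|} =
      P.map X {y | t < |f y - ∫ z, f z ∂(P.map X)|} := by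
    rw [Measure.map_apply hX (MeasurableSet.of_discrete), hmean]
    rfl
  rw [hset]
  refine CubeConc.le_two_mul_exp_neg (measure_ne_top _ _) hc fun r hr hrE => ?_
  have hh : ∀ y, specNorm (H y) ≤ ⨆ x, specNorm (H x) :=
    le_ciSup (Set.finite_range _).bddAbove
  have hF : ∀ y, frobNorm (H y) ^ 2 ≤ ⨆ x, frobNorm (H x) ^ 2 :=
    le_ciSup (f := fun x => frobNorm (H x) ^ 2) (Set.finite_range _).bddAbove
  unfold tailExponent at hrE
  rw [CubeConc.norm_integral_sq hX] at hrE
  refine CubeConc.real_tail_le hC hW.pos hW.logSobolev hD hH hh hF ht hr ?_ ?_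
  · have h1 := ENNReal.mul_le_of_le_div (hrE.trans (min_le_left _ _))
    rwa [← ENNReal.ofReal_mul hr, ENNReal.ofReal_le_ofReal_iff (sq_nonneg t)] at h1
  · have h1 := ENNReal.mul_le_of_le_div (hrE.trans (min_le_right _ _))
    rwa [← ENNReal.ofReal_mul hr, ENNReal.ofReal_le_ofReal_iff ht.le] at h1
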